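/- Let $n\ge 2$ and let $\mathscr P\subset\mathbb H^n$ be a compact convex right-angled polytope (all dihedral angles between adjacent facets, i.e. facets sharing a face of codimension two, equal $\pi/2$). Let $\Gamma=\langle r_F \mid r_F^2,\ [r_F,r_{F'}]\rangle$, where $F$ ranges over the facets of $\mathscr P$ and $F,F'$ over the pairs of adjacent facets; $\Gamma$ acts on $\mathbb H^n$, with $r_F$ acting as the reflection in the hyperplane containing $F$. Let $V$ be a finite-dimensional vector space over $\mathbb F_2$ and let $\lambda$ be a $V$-colouring of $\mathscr P$, i.e. an assignment of a vector $\lambda_F\in V$ to each facet $F$ such that at every vertex of $\mathscr P$ the colours of the facets containing that vertex are linearly independent. Let $\lambda\colon\Gamma\to V$ also denote the homomorphism with $r_F\mapsto\lambda_F$, let $\Gamma_\lambda$ be its kernel, and let $M_\lambda=\mathbb H^n/\Gamma_\lambda$. Then $M_\lambda$ is a (Hausdorff, smooth) manifold, with the smooth structure for which $\mathbb H^n\to M_\lambda$ is a local diffeomorphism, and: 1. If the colours $\lambda_F$ span $V$, then $M_\lambda$ is orientable if and only if there are $s$ and an isomorphism $V\cong\mathbb F_2^s$ under which every colour $\lambda_F$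 has an odd number of coordinates equal to $1$. 2. If there are facets $F,F',F''$ of $\mathscr P$ with $\lambda_F+\lambda_{F'}+\lambda_{F''}=0$, then $M_\lambda$ is not orientable. -/

import Mathlib

open scoped ContDiff Manifold

noncomputable section

/-! ### Hyperbolic space (hyperboloid model) -/

/-- Minkowski space `ℝ^{n,1}`: a time coordinate and `n` space coordinates. -/
abbrev Minkowski (n : ℕ) : Type := ℝ × EuclideanSpace ℝ (Fin n)

/-- The Lorentzian form `⟨x, y⟩ = x₁y₁ + ⋯ + xₙyₙ - x₀y₀`. -/
def lorentz {n : ℕ} (x y : Minkowski n) : ℝ := inner ℝ x.2 y.2 - x.1 * y.1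

/-- Hyperbolic `n`-space: the upper sheet of the hyperboloid `⟨x, x⟩ = -1`. -/
abbrev Hyp (n : ℕ) : Type := {x : Minkowski n // lorentz x x = -1 ∧ 0 < x.1}

namespace Hyp

variable {n : ℕ}

/-- The inclusion into Minkowski space. -/
def toMink (x : Hyp n) : Minkowski n := x.1

theorem time_eq (x : Hyp n) : x.1.1 = √(1 + ‖x.1.2‖ ^ 2) := by
  have h := x.2.1
  unfold lorentz at h
  rw [real_inner_self_eq_norm_sq] at h
  rw [eq_comm, Real.sqrt_eq_iff_mul_self_eq (by positivity) x.2.2.le]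
  linarith

/-- The hyperboloid is the graph of `v ↦ √(1 + ‖v‖²)`; projecting to the space coordinates is a
global chart, which defines its standard smooth structure. -/
def globalChart (n : ℕ) : Hyp n ≃ₜ EuclideanSpace ℝ (Fin n) where
  toFun x := x.1.2
  invFun v := ⟨(√(1 + ‖v‖ ^ 2), v), by
    unfold lorentz
    refine ⟨?_, Real.sqrt_pos.2 (by positivity)⟩
    rw [real_inner_self_eq_norm_sq, Real.mul_self_sqrt (by positivity)]
    ring⟩
  left_inv x := Subtype.ext (Prod.ext (time_eq x).symm rfl)
  right_inv _ := rfl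
  continuous_toFun := continuous_snd.comp continuous_subtype_val
  continuous_invFun := Continuous.subtype_mk (by fun_prop) _

instance : ChartedSpace (EuclideanSpace ℝ (Fin n)) (Hyp n) :=
  (globalChart n).toOpenPartialHomeomorph.singletonChartedSpace rfl

instance : IsManifold 𝓘(ℝ, EuclideanSpace ℝ (Fin n)) ∞ (Hyp n) :=
  (globalChart n).toOpenPartialHomeomorph.isManifold_singleton rfl

end Hyp

/-- The linear reflection of Minkowski space in the hyperplane orthogonal to a unit vector `e`. -/
def lorentzReflect {n : ℕ} (e x : Minkowski n) : Minkowski n := x - (2 * lorentz x e) • e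

section lorentz

variable {n : ℕ}

theorem lorentz_comm (x y : Minkowski n) : lorentz x y = lorentz y x := by
  simp only [lorentz, real_inner_comm]; ring

theorem lorentz_sub_smul_left (x y e : Minkowski n) (c : ℝ) :
    lorentz (x - c • e) y = lorentz x y - c * lorentz e y := by
  simp only [lorentz, Prod.fst_sub, Prod.snd_sub, Prod.smul_fst, Prod.smul_snd, inner_sub_left,
    real_inner_smul_left, smul_eq_mul]
  ring

theorem lorentz_sub_smul_right (x y e : Minkowski n) (c : ℝ) :
    lorentz y (x - c • e) = lorentz y x - c * lorentz y e := by
  rw [lorentz_comm, lorentz_sub_smul_left, lorentz_comm x, lorentz_comm e]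

theorem lorentz_reflect_reflect {e : Minkowski n} (he : lorentz e e = 1) (x y : Minkowski n) :
    lorentz (lorentzReflect e x) (lorentzReflect e y) = lorentz x y := by
  simp only [lorentzReflect, lorentz_sub_smul_left, lorentz_sub_smul_right, he]
  rw [lorentz_comm e y]; ring

theorem lorentzReflect_involutive {e : Minkowski n} (he : lorentz e e = 1) :
    Function.Involutive (lorentzReflect e) := by
  intro x
  simp only [lorentzReflect, lorentz_sub_smul_left, he]
  module

theorem lorentzReflect_commute {e f : Minkowski n} (h : lorentz e f = 0) (x : Minkowski n) :
    lorentzReflect e (lorentzReflect f x) = lorentzReflect f (lorentzReflect e x) := by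
  have h' : lorentz f e = 0 := by rw [lorentz_comm, h]
  simp only [lorentzReflect, lorentz_sub_smul_left, h, h']
  module

theorem lorentz_neg_of_time_pos {x y : Minkowski n} (hx : lorentz x x = -1) (hx0 : 0 < x.1)
    (hy : lorentz y y = -1) (hy0 : 0 < y.1) : lorentz x y < 0 := by
  unfold lorentz at *
  rw [real_inner_self_eq_norm_sq] at hx hy
  have h1 : ‖x.2‖ < x.1 := by nlinarith [norm_nonneg x.2]
  have h2 : ‖y.2‖ < y.1 := by nlinarith [norm_nonneg y.2]
  have h3 := real_inner_le_norm x.2 y.2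
  nlinarith [mul_lt_mul'' h1 h2 (norm_nonneg _) (norm_nonneg _)]

theorem lorentzReflect_mem {e : Minkowski n} (he : lorentz e e = 1) (x : Hyp n) :
    lorentz (lorentzReflect e x.1) (lorentzReflect e x.1) = -1 ∧
      0 < (lorentzReflect e x.1).1 := by
  have h1 : lorentz (lorentzReflect e x.1) (lorentzReflect e x.1) = -1 := by
    rw [lorentz_reflect_reflect he]; exact x.2.1
  refine ⟨h1, ?_⟩
  by_contra hneg
  have hxy : lorentz x.1 (lorentzReflect e x.1) < 0 := by
    rw [lorentzReflect, lorentz_sub_smul_right, x.2.1]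
    nlinarith [sq_nonneg (lorentz x.1 e)]
  have h2 : lorentz (-lorentzReflect e x.1) (-lorentzReflect e x.1) = -1 := by
    refine Eq.trans ?_ h1
    simp [lorentz]
  have hne : (lorentzReflect e x.1).1 ≠ 0 := by
    intro h0
    have := h1
    unfold lorentz at this
    rw [h0, real_inner_self_eq_norm_sq] at this
    nlinarith [sq_nonneg ‖(lorentzReflect e x.1).2‖]
  have h3 : 0 < (-lorentzReflect e x.1).1 := by
    have := lt_of_le_of_ne (not_lt.1 hneg) hne
    simpa using this
  have h4 := lorentz_neg_of_time_pos x.2.1 x.2.2 h2 h3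
  have h5 : lorentz x.1 (-lorentzReflect e x.1) = -lorentz x.1 (lorentzReflect e x.1) := by
    simp [lorentz]; ring
  linarith

end lorentz

/-- The reflection of hyperbolic space in the hyperplane `{x | ⟨x, e⟩ = 0}`. -/
def Hyp.reflection {n : ℕ} (e : Minkowski n) (he : lorentz e e = 1) : Equiv.Perm (Hyp n) :=
  Function.Involutive.toPerm (fun x => ⟨lorentzReflect e x.1, lorentzReflect_mem he x⟩)
    (fun x => Subtype.ext (lorentzReflect_involutive he x.1))

/-! ### Right-angled polytopes -/

/-- A compact convex polytope in `ℍⁿ`, whose facets are indexed by `ι`: it is the intersection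
of the half-spaces `{x | ⟨x, normal i⟩ ≤ 0}`, it has interior points, and each bounding hyperplane
cuts out a facet, different ones for different indices. A face of dimension `k` is one that spans a
`(k+1)`-dimensional linear subspace of Minkowski space. -/
structure HypPolytope (n : ℕ) (ι : Type*) where
  /-- the outward unit normal of each facet -/
  normal : ι → Minkowski n
  finite : Finite ι
  normal_unit : ∀ i, lorentz (normal i) (normal i) = 1
  normal_injective : Function.Injective normal
  isCompact : IsCompact {x : Hyp n | ∀ i, lorentz x.toMink (normal i) ≤ 0}
  exists_interior : ∃ x : Hyp n, ∀ i, lorentz x.toMink (normal i) < 0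
  facet_dim : ∀ i, Module.finrank ℝ (Submodule.span ℝ (Hyp.toMink ''
    {x : Hyp n | (∀ j, lorentz x.toMink (normal j) ≤ 0) ∧ lorentz x.toMink (normal i) = 0})) = n

namespace HypPolytope

variable {n : ℕ} {ι : Type*} (P : HypPolytope n ι)

/-- The polytope as a subset of hyperbolic space. -/
def carrier : Set (Hyp n) := {x | ∀ i, lorentz x.toMink (P.normal i) ≤ 0}

/-- The facet with index `i`. -/
def facet (i : ι) : Set (Hyp n) := {x | x ∈ P.carrier ∧ lorentz x.toMink (P.normal i) = 0}

/-- Two different facets are adjacent if they share a face of codimension two. -/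
def Adjacent (i j : ι) : Prop :=
  i ≠ j ∧ Module.finrank ℝ (Submodule.span ℝ (Hyp.toMink '' (P.facet i ∩ P.facet j))) + 1 = n

theorem Adjacent.symm {P : HypPolytope n ι} {i j : ι} (h : P.Adjacent i j) : P.Adjacent j i :=
  ⟨h.1.symm, by rw [Set.inter_comm]; exact h.2⟩

/-- A vertex: a point of the polytope that is the only one lying on all the facets through it,
that is, a face of dimension zero. -/
def IsVertex (v : Hyp n) : Prop :=
  v ∈ P.carrier ∧ ∀ x ∈ P.carrier, (∀ i, v ∈ P.facet i → x ∈ P.facet i) → x = v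

end HypPolytope

/-- A compact right-angled polytope in `ℍⁿ`: all the dihedral angles (the angles between
adjacent facets) are right angles. -/
structure RightAngledPolytope (n : ℕ) (ι : Type*) extends HypPolytope n ι where
  right_angled : ∀ i j, toHypPolytope.Adjacent i j → lorentz (normal i) (normal j) = 0

namespace RightAngledPolytope

variable {n : ℕ} {ι : Type*} (P : RightAngledPolytope n ι)

open Classical in
/-- The Coxeter matrix with entry `2` for adjacent facets and `∞` (coded as `0`) for different
facets that are not adjacent. -/
def coxeterMatrix : CoxeterMatrix ι where
  M i j := if i = j then 1 else if P.Adjacent i j then 2 else 0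
  isSymm := by
    ext i j
    have h : P.Adjacent i j ↔ P.Adjacent j i := ⟨fun h => h.symm, fun h => h.symm⟩
    change (if j = i then 1 else if P.Adjacent j i then 2 else 0) =
      (if i = j then 1 else if P.Adjacent i j then 2 else 0)
    simp only [eq_comm (a := i) (b := j), h]
  diagonal i := by simp
  off_diagonal i j hij := by simp only [if_neg hij]; split_ifs <;> simp

/-- The right-angled Coxeter group `Γ = ⟨r_F | r_F², [r_F, r_F'] for F, F' adjacent⟩`. -/
def CoxeterGroup : Type _ := P.coxeterMatrix.Group

instance : Group P.CoxeterGroup := inferInstanceAs (Group P.coxeterMatrix.Group)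

/-- The generator `r_F`. -/
def gen (F : ι) : P.CoxeterGroup := P.coxeterMatrix.simple F

/-- Elements `f F` of order dividing two, commuting for adjacent facets, extend to a homomorphism
on the Coxeter group. -/
theorem isLiftable {G : Type*} [Group G] (f : ι → G) (hsq : ∀ i, f i * f i = 1)
    (hcomm : ∀ i j, P.Adjacent i j → f i * f j = f j * f i) :
    P.coxeterMatrix.IsLiftable f := by
  classical
  intro i j
  have hM : P.coxeterMatrix i j = if i = j then 1 else if P.Adjacent i j then 2 else 0 := by
    simp [coxeterMatrix]
  rw [hM]
  split_ifs with h1 h2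
  · subst h1; simpa using hsq i
  · rw [(Commute.mul_pow (hcomm i j h2)), pow_two, pow_two, hsq, hsq, one_mul]
  · simp

/-- The homomorphism `Γ → G` with `r_F ↦ f F`. -/
def liftHom {G : Type*} [Group G] (f : ι → G) (hsq : ∀ i, f i * f i = 1)
    (hcomm : ∀ i j, P.Adjacent i j → f i * f j = f j * f i) : P.CoxeterGroup →* G :=
  P.coxeterMatrix.toCoxeterSystem.lift ⟨f, P.isLiftable f hsq hcomm⟩

theorem liftHom_gen {G : Type*} [Group G] (f : ι → G) (hsq : ∀ i, f i * f i = 1)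
    (hcomm : ∀ i j, P.Adjacent i j → f i * f j = f j * f i) (F : ι) :
    P.liftHom f hsq hcomm (P.gen F) = f F :=
  P.coxeterMatrix.toCoxeterSystem.lift_apply_simple (P.isLiftable f hsq hcomm) F

/-- The action of `Γ` on `ℍⁿ`, in which `r_F` is the reflection in the hyperplane containing the
facet `F`. -/
def action : P.CoxeterGroup →* Equiv.Perm (Hyp n) :=
  P.liftHom (fun F => Hyp.reflection (P.normal F) (P.normal_unit F))
    (fun F => Equiv.ext fun x => Subtype.ext (lorentzReflect_involutive (P.normal_unit F) x.1))
    (fun F G h => Equiv.ext fun x => Subtype.ext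
      (lorentzReflect_commute (P.right_angled F G h) x.1))

instance : MulAction P.CoxeterGroup (Hyp n) := MulAction.compHom (Hyp n) P.action

end RightAngledPolytope

/-! ### Colourings and their covers -/

/-- A `V`-colouring of a right-angled polytope: a vector for each facet, such that the vectors of
the facets through any given vertex are linearly independent. -/
structure Colouring {n : ℕ} {ι : Type*} (P : RightAngledPolytope n ι) (V : Type*)
    [AddCommGroup V] [Module (ZMod 2) V] where
  colour : ι → V
  linearIndependent : ∀ v : Hyp n, P.IsVertex v →
    LinearIndependent (ZMod 2) (fun F : {F : ι // v ∈ P.facet F} => colour F)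

namespace Colouring

variable {n : ℕ} {ι : Type*} {P : RightAngledPolytope n ι} {V : Type*}
  [AddCommGroup V] [Module (ZMod 2) V] (c : Colouring P V)

/-- The colouring spans `V`. -/
def Spans : Prop := Submodule.span (ZMod 2) (Set.range c.colour) = ⊤

/-- The homomorphism `λ : Γ → V` with `r_F ↦ λ_F`. -/
def hom : P.CoxeterGroup →* Multiplicative V :=
  P.liftHom (fun F => Multiplicative.ofAdd (c.colour F))
    (fun F => by
      rw [← ofAdd_add, ← two_smul (ZMod 2) (c.colour F), show (2 : ZMod 2) = 0 from rfl, zero_smul,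
        ofAdd_zero])
    (fun F G _ => mul_comm _ _)

/-- `M_λ = ℍⁿ / ker λ`, with the quotient topology. -/
def Cover : Type := MulAction.orbitRel.Quotient c.hom.ker (Hyp n)

instance : TopologicalSpace c.Cover :=
  inferInstanceAs (TopologicalSpace (MulAction.orbitRel.Quotient c.hom.ker (Hyp n)))

/-- The projection `ℍⁿ → M_λ`. -/
def proj (x : Hyp n) : c.Cover := (Quotient.mk _ x : MulAction.orbitRel.Quotient c.hom.ker (Hyp n))

end Colouring

/-- A smooth `n`-manifold is orientable if its points are covered by a family of smooth charts all
of whose coordinate changes have positive Jacobian determinant. -/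
def IsOrientable (n : ℕ) (M : Type*) [TopologicalSpace M]
    [ChartedSpace (EuclideanSpace ℝ (Fin n)) M] : Prop :=
  ∃ A : Set (OpenPartialHomeomorph M (EuclideanSpace ℝ (Fin n))),
    A ⊆ IsManifold.maximalAtlas 𝓘(ℝ, EuclideanSpace ℝ (Fin n)) ∞ M ∧
    (∀ x : M, ∃ e ∈ A, x ∈ e.source) ∧
    ∀ e ∈ A, ∀ e' ∈ A, ∀ x ∈ (e.symm.trans e').source,
      0 < (fderiv ℝ (e.symm.trans e') x).det

end

/-! `M_λ` is orientable exactly when `Γ_λ` contains no orientation-reversing element. In the global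
chart every generator of `Γ` has negative Jacobian determinant, so the Jacobian of `w` has the sign
`(-1)^{length w}` (`sign_mul_det_pos`), and orientability means that this sign is trivial on `Γ_λ`
(`Colouring.isOrientable_iff`). If the colours span, `V` is `Γ/Γ_λ`, so triviality on the kernel
says that the parity descends to a functional on `V` with value `1` on every colour; in a basis
chosen among the colours this functional is the sum of the coordinates. Three colours with sum zero
put a product of three reflections, which is odd, into `Γ_λ`.

That `M_λ` is a Hausdorff manifold needs `Γ_λ` to act freely and properly discontinuously, which
rests on the polytope being a strict fundamental domain for `Γ`. Right angles between adjacent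
facets force the normals to have product `0` (adjacent) or at most `-1` (not adjacent):
`lorentz_normal_nonpos`, `adjacent_of_neg_one_lt`. With these products, an induction on length in
the style of Tits (`supports_aux`) shows that no translate of a wall cuts the polytope. Hence point
stabilisers are generated by the reflections in the facets through the point
(`eq_and_mem_closure_of_smul_mem`), and translates of an interior point are uniformly separated,
which gives proper discontinuity. An element of `Γ_λ` with a fixed point is conjugate into the group
generated by the reflections in the facets through a vertex; there the independence of the colours
makes `λ` injective, so the element is trivial (`eq_one_of_smul_eq`).

Throughout, `-⟨x, y⟩`, the hyperbolic cosine of the distance, replaces the metric. -/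

noncomputable section

open Filter Topology

/-! ### Lorentzian linear algebra -/

section Minkowski

variable {n : ℕ}

theorem lorentz_add_left (x y z : Minkowski n) : lorentz (x + y) z = lorentz x z + lorentz y z := by
  simp only [lorentz, Prod.fst_add, Prod.snd_add, inner_add_left]; ring

theorem lorentz_smul_left (c : ℝ) (x y : Minkowski n) : lorentz (c • x) y = c * lorentz x y := by
  simp only [lorentz, Prod.smul_fst, Prod.smul_snd, real_inner_smul_left, smul_eq_mul]; ring

theorem lorentz_add_right (x y z : Minkowski n) : lorentz x (y + z) = lorentz x y + lorentz x z := by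
  rw [lorentz_comm, lorentz_add_left, lorentz_comm y, lorentz_comm z]

theorem lorentz_smul_right (c : ℝ) (x y : Minkowski n) : lorentz x (c • y) = c * lorentz x y := by
  rw [lorentz_comm, lorentz_smul_left, lorentz_comm y]

theorem lorentz_neg_left (x y : Minkowski n) : lorentz (-x) y = -lorentz x y := by
  rw [← neg_one_smul ℝ, lorentz_smul_left, neg_one_mul]

theorem lorentz_neg_right (x y : Minkowski n) : lorentz x (-y) = -lorentz x y := by
  rw [lorentz_comm, lorentz_neg_left, lorentz_comm]

/-- The linear functional `⟨·, e⟩`. -/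
def lorentzDual (e : Minkowski n) : Module.Dual ℝ (Minkowski n) where
  toFun x := lorentz x e
  map_add' x y := lorentz_add_left x y e
  map_smul' c x := lorentz_smul_left c x e

theorem lorentzDual_apply (e x : Minkowski n) : lorentzDual e x = lorentz x e := rfl

theorem mem_ker_lorentzDual {e x : Minkowski n} :
    x ∈ LinearMap.ker (lorentzDual e) ↔ lorentz x e = 0 := Iff.rfl

theorem lorentz_zero_left (e : Minkowski n) : lorentz 0 e = 0 := (lorentzDual e).map_zero

theorem lorentz_sum_left {κ : Type*} (s : Finset κ) (f : κ → Minkowski n) (e : Minkowski n) :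
    lorentz (∑ k ∈ s, f k) e = ∑ k ∈ s, lorentz (f k) e :=
  map_sum (lorentzDual e) f s

theorem eq_zero_of_forall_lorentz_eq_zero {w : Minkowski n} (h : ∀ z, lorentz z w = 0) : w = 0 := by
  -- Flipping the time coordinate turns the form into the Euclidean square of `w`.
  have h1 := h (-w.1, w.2)
  simp only [lorentz, real_inner_self_eq_norm_sq] at h1
  have h2 : w.1 = 0 := by nlinarith [sq_nonneg w.1, sq_nonneg ‖w.2‖]
  have h3 : ‖w.2‖ = 0 := by nlinarith [sq_nonneg w.1, sq_nonneg ‖w.2‖]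
  exact Prod.ext h2 (norm_eq_zero.1 h3)

theorem continuous_lorentz : Continuous fun p : Minkowski n × Minkowski n => lorentz p.1 p.2 := by
  unfold lorentz; fun_prop

@[fun_prop]
theorem Continuous.lorentz {X : Type*} [TopologicalSpace X] {f g : X → Minkowski n}
    (hf : Continuous f) (hg : Continuous g) : Continuous fun x => lorentz (f x) (g x) :=
  continuous_lorentz.comp (hf.prodMk hg)

theorem finrank_ker_lorentzDual {e : Minkowski n} (he : lorentz e e = 1) :
    Module.finrank ℝ (LinearMap.ker (lorentzDual e)) = n := by
  have h0 : lorentzDual e ≠ 0 := by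
    intro h
    have := DFunLike.congr_fun h e
    rw [lorentzDual_apply, he] at this
    exact one_ne_zero this
  have h1 := Module.Dual.finrank_ker_add_one_of_ne_zero h0
  have h2 : Module.finrank ℝ (Minkowski n) = n + 1 := by
    rw [Module.finrank_prod, Module.finrank_self, finrank_euclideanSpace_fin, add_comm]
  omega

/-- Future-pointing timelike vectors. -/
def IsFuture (z : Minkowski n) : Prop := lorentz z z < 0 ∧ 0 < z.1

theorem isOpen_isFuture : IsOpen {z : Minkowski n | IsFuture z} :=
  (isOpen_lt (continuous_id.lorentz continuous_id) continuous_const).inter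
    (isOpen_lt continuous_const continuous_fst)

theorem Hyp.isFuture (x : Hyp n) : IsFuture x.1 := ⟨by rw [x.2.1]; norm_num, x.2.2⟩

theorem IsFuture.norm_lt {x : Minkowski n} (hx : IsFuture x) : ‖x.2‖ < x.1 := by
  have h := hx.1
  rw [lorentz, real_inner_self_eq_norm_sq] at h
  nlinarith [norm_nonneg x.2, hx.2]

/-- Cauchy–Schwarz on the space parts, each of which is shorter than its time part. -/
theorem IsFuture.lorentz_neg {x y : Minkowski n} (hx : IsFuture x) (hy : IsFuture y) :
    lorentz x y < 0 := by
  have h3 := real_inner_le_norm x.2 y.2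
  have := mul_lt_mul'' hx.norm_lt hy.norm_lt (norm_nonneg _) (norm_nonneg _)
  unfold lorentz
  linarith

theorem IsFuture.add {x y : Minkowski n} (hx : IsFuture x) (hy : IsFuture y) :
    IsFuture (x + y) := by
  refine ⟨?_, add_pos hx.2 hy.2⟩
  rw [lorentz_add_left, lorentz_add_right, lorentz_add_right, lorentz_comm y x]
  linarith [hx.1, hy.1, hx.lorentz_neg hy]

theorem IsFuture.smul {x : Minkowski n} (hx : IsFuture x) {c : ℝ} (hc : 0 < c) :
    IsFuture (c • x) := by
  refine ⟨?_, mul_pos hc hx.2⟩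
  rw [lorentz_smul_left, lorentz_smul_right]
  exact mul_neg_of_pos_of_neg hc (mul_neg_of_pos_of_neg hc hx.1)

theorem IsFuture.of_lorentz_neg {x z : Minkowski n} (hx : IsFuture x) (hz : lorentz z z < 0)
    (hxz : lorentz x z < 0) : IsFuture z := by
  refine ⟨hz, ?_⟩
  by_contra h
  have h1 : z.1 ≠ 0 := by
    intro h0
    rw [lorentz, real_inner_self_eq_norm_sq, h0] at hz
    nlinarith [sq_nonneg ‖z.2‖]
  have h2 : IsFuture (-z) := by
    refine ⟨by rw [lorentz_neg_left, lorentz_neg_right, neg_neg]; exact hz, ?_⟩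
    have := lt_of_le_of_ne (not_lt.1 h) h1
    simpa using this
  have := hx.lorentz_neg h2
  rw [lorentz_neg_right] at this
  linarith

theorem IsFuture.exists_normalize {z : Minkowski n} (hz : IsFuture z) :
    ∃ (x : Hyp n) (c : ℝ), 0 < c ∧ x.toMink = c • z := by
  have h0 : 0 < -lorentz z z := by linarith [hz.1]
  have hs := Real.sqrt_pos.2 h0
  refine ⟨⟨(√(-lorentz z z))⁻¹ • z, ?_, mul_pos (inv_pos.2 hs) hz.2⟩, _, inv_pos.2 hs, rfl⟩
  rw [lorentz_smul_left, lorentz_smul_right]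
  have := Real.mul_self_sqrt h0.le
  field_simp
  rw [pow_two, this, neg_neg]

/-- Vectors orthogonal to a timelike vector are spacelike. -/
theorem IsFuture.lorentz_pos_of_orthogonal {x u : Minkowski n} (hx : IsFuture x)
    (h : lorentz x u = 0) (hu : u ≠ 0) : 0 < lorentz u u := by
  have h1 := hx.norm_lt
  have h2 := abs_real_inner_le_norm x.2 u.2
  have h3 : (inner ℝ x.2 u.2 : ℝ) = x.1 * u.1 := by unfold lorentz at h; linarith
  rw [h3, abs_mul, abs_of_pos hx.2] at h2
  have h4 : 0 < ‖u.2‖ := by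
    rw [norm_pos_iff]
    intro h0
    rw [h0, norm_zero, mul_zero] at h2
    have : |u.1| = 0 := by nlinarith [abs_nonneg u.1, hx.2]
    exact hu (Prod.ext (abs_eq_zero.1 this) h0)
  have h5 : |u.1| < ‖u.2‖ := by
    by_contra h6
    nlinarith [hx.2]
  rw [lorentz, real_inner_self_eq_norm_sq, ← pow_two, ← sq_abs u.1]
  nlinarith [abs_nonneg u.1]

/-- The component `y + ⟨x, y⟩ x` of `y` orthogonal to `x` is nonzero, hence spacelike, and its
square is `⟨x, y⟩² - 1`. -/
theorem Hyp.lorentz_lt_neg_one {x y : Hyp n} (h : x ≠ y) : lorentz x.1 y.1 < -1 := by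
  have h0 := x.isFuture.lorentz_neg y.isFuture
  have hx := x.2.1
  have hy := y.2.1
  have h1 : lorentz x.1 (y.1 + lorentz x.1 y.1 • x.1) = 0 := by
    rw [lorentz_add_right, lorentz_smul_right, hx]; ring
  by_cases h2 : y.1 + lorentz x.1 y.1 • x.1 = 0
  · exfalso
    have h3 : lorentz y.1 (y.1 + lorentz x.1 y.1 • x.1) = 0 := by
      rw [h2, lorentz_comm, lorentz_zero_left]
    rw [lorentz_add_right, lorentz_smul_right, hy, lorentz_comm y.1 x.1] at h3
    have h4 : lorentz x.1 y.1 = -1 := by nlinarith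
    rw [h4] at h2
    apply h
    apply Subtype.ext
    rw [neg_one_smul, ← sub_eq_add_neg, sub_eq_zero] at h2
    exact h2.symm
  · have h3 := x.isFuture.lorentz_pos_of_orthogonal h1 h2
    rw [lorentz_add_left, lorentz_smul_left, h1, lorentz_add_right,
      lorentz_smul_right, hy, lorentz_comm y.1 x.1] at h3
    nlinarith

end Minkowski

/-- A vector space over an infinite field is not a finite union of proper subspaces. -/
theorem Submodule.exists_mem_forall_notMem {E κ : Type*} [AddCommGroup E] [Module ℝ E] [Finite κ]
    (A : Submodule ℝ E) (U : κ → Submodule ℝ E) (h : ∀ k, ¬ A ≤ U k) :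
    ∃ q ∈ A, ∀ k, q ∉ U k := by
  cases nonempty_fintype κ
  classical
  have key := Subspace.biUnion_ne_univ_of_top_notMem
    (s := Finset.univ.image fun k => (U k).comap A.subtype) (by
      intro hk
      obtain ⟨k, -, hk⟩ := Finset.mem_image.1 hk
      refine h k fun x hx => ?_
      have : (⟨x, hx⟩ : A) ∈ (U k).comap A.subtype := hk ▸ Submodule.mem_top
      exact this)
  obtain ⟨q, hq⟩ := (Set.ne_univ_iff_exists_notMem _).1 key
  simp only [Finset.mem_image, Finset.mem_univ, true_and, Set.mem_iUnion, not_exists] at hq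
  exact ⟨q, q.2, fun k hk => hq _ ⟨k, rfl⟩ hk⟩

/-! ### Facets, their hyperplanes and relative interiors -/

namespace HypPolytope

variable {n : ℕ} {ι : Type*} (P : HypPolytope n ι)

theorem normal_add_ne_zero (i j : ι) : P.normal i + P.normal j ≠ 0 := by
  intro h
  obtain ⟨x, hx⟩ := P.exists_interior
  have h1 : lorentz x.toMink (P.normal i + P.normal j) = 0 := by
    rw [h, lorentz_comm, lorentz_zero_left]
  rw [lorentz_add_right] at h1
  linarith [hx i, hx j]

theorem facet_nonempty (hn : 2 ≤ n) (i : ι) : (P.facet i).Nonempty := by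
  by_contra h
  rw [Set.not_nonempty_iff_eq_empty] at h
  have h1 : Module.finrank ℝ (Submodule.span ℝ (Hyp.toMink '' P.facet i)) = n := P.facet_dim i
  rw [h, Set.image_empty, Submodule.span_empty, finrank_bot] at h1
  omega

/-- The hyperplane through a facet is the linear span of the facet. -/
theorem span_facet (i : ι) :
    Submodule.span ℝ (Hyp.toMink '' P.facet i) = LinearMap.ker (lorentzDual (P.normal i)) := by
  apply Submodule.eq_of_le_of_finrank_eq
  · rw [Submodule.span_le]
    rintro _ ⟨x, hx, rfl⟩
    exact hx.2
  · rw [finrank_ker_lorentzDual (P.normal_unit i)]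
    exact P.facet_dim i

/-- An inclusion would make the unit normals equal or opposite; opposite ones are excluded by an
interior point, equal ones by injectivity. -/
theorem not_ker_le_ker {i j : ι} (hij : i ≠ j) :
    ¬ LinearMap.ker (lorentzDual (P.normal i)) ≤ LinearMap.ker (lorentzDual (P.normal j)) := by
  intro h
  have h1 : P.normal j - lorentz (P.normal i) (P.normal j) • P.normal i = 0 := by
    apply eq_zero_of_forall_lorentz_eq_zero
    intro z
    have h2 : z - lorentz z (P.normal i) • P.normal i ∈
        LinearMap.ker (lorentzDual (P.normal i)) := by
      rw [mem_ker_lorentzDual, lorentz_sub_smul_left, P.normal_unit]; ring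
    have h3 := mem_ker_lorentzDual.1 (h h2)
    rw [lorentz_sub_smul_left] at h3
    rw [lorentz_sub_smul_right]
    linarith
  rw [sub_eq_zero] at h1
  have h2 := P.normal_unit j
  rw [h1, lorentz_smul_left, lorentz_smul_right, P.normal_unit] at h2
  have h3 : (lorentz (P.normal i) (P.normal j) - 1) * (lorentz (P.normal i) (P.normal j) + 1) = 0 := by
    linarith
  rcases mul_eq_zero.1 h3 with h4 | h4
  · rw [sub_eq_zero.1 h4, one_smul] at h1
    exact hij (P.normal_injective h1.symm)
  · rw [eq_neg_of_add_eq_zero_left h4, neg_one_smul] at h1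
    exact P.normal_add_ne_zero i j (by rw [h1, add_neg_cancel])

theorem finrank_ker_inf_ker {i j : ι} (hij : i ≠ j) :
    Module.finrank ℝ (LinearMap.ker (lorentzDual (P.normal i)) ⊓
      LinearMap.ker (lorentzDual (P.normal j)) : Submodule ℝ (Minkowski n)) + 1 = n := by
  have h1 := Submodule.finrank_sup_add_finrank_inf_eq (LinearMap.ker (lorentzDual (P.normal i)))
    (LinearMap.ker (lorentzDual (P.normal j)))
  rw [finrank_ker_lorentzDual (P.normal_unit i), finrank_ker_lorentzDual (P.normal_unit j)] at h1
  have h2 : LinearMap.ker (lorentzDual (P.normal j)) <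
      LinearMap.ker (lorentzDual (P.normal i)) ⊔ LinearMap.ker (lorentzDual (P.normal j)) := by
    refine lt_of_le_of_ne le_sup_right fun h => P.not_ker_le_ker hij ?_
    exact le_sup_left.trans h.symm.le
  have h3 := Submodule.finrank_lt_finrank_of_lt h2
  rw [finrank_ker_lorentzDual (P.normal_unit j)] at h3
  have h4 : Module.finrank ℝ (Minkowski n) = n + 1 := by
    rw [Module.finrank_prod, Module.finrank_self, finrank_euclideanSpace_fin, add_comm]
  have h5 := Submodule.finrank_le (LinearMap.ker (lorentzDual (P.normal i)) ⊔
    LinearMap.ker (lorentzDual (P.normal j)))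
  omega

theorem span_facet_inter_le (i j : ι) :
    Submodule.span ℝ (Hyp.toMink '' (P.facet i ∩ P.facet j)) ≤
      LinearMap.ker (lorentzDual (P.normal i)) ⊓ LinearMap.ker (lorentzDual (P.normal j)) := by
  rw [Submodule.span_le]
  rintro _ ⟨x, hx, rfl⟩
  exact ⟨hx.1.2, hx.2.2⟩

theorem finrank_span_facet_inter_lt {i j : ι} (hij : i ≠ j) (h : ¬ P.Adjacent i j) :
    Module.finrank ℝ (Submodule.span ℝ (Hyp.toMink '' (P.facet i ∩ P.facet j))) + 1 < n := by
  have h1 := Submodule.finrank_mono (P.span_facet_inter_le i j)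
  have h2 := P.finrank_ker_inf_ker hij
  have h3 : Module.finrank ℝ (Submodule.span ℝ (Hyp.toMink '' (P.facet i ∩ P.facet j))) + 1 ≠ n :=
    fun h4 => h ⟨hij, h4⟩
  omega

/-- A future-pointing vector satisfying the inequalities of the polytope spans a ray through a
point of the polytope. -/
theorem exists_mem_carrier {z : Minkowski n} (hz : IsFuture z)
    (h : ∀ i, lorentz z (P.normal i) ≤ 0) :
    ∃ x ∈ P.carrier, ∃ c : ℝ, 0 < c ∧ x.toMink = c • z := by
  obtain ⟨x, c, hc, hx⟩ := hz.exists_normalize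
  refine ⟨x, fun i => ?_, c, hc, hx⟩
  rw [hx, lorentz_smul_left]
  exact mul_nonpos_of_nonneg_of_nonpos hc.le (h i)

/-- The relative interior of a facet is not empty. -/
theorem exists_relint (hn : 2 ≤ n) (i : ι) : ∃ p, IsFuture p ∧ lorentz p (P.normal i) = 0 ∧
    ∀ j, j ≠ i → lorentz p (P.normal j) < 0 := by
  have := P.finite
  cases nonempty_fintype ι
  -- The facet spans its hyperplane, so it does not lie inside any other one. Summing the witnesses
  -- over `j` makes all inequalities strict at once.
  have h1 : ∀ j, ∃ x ∈ P.facet i, j ≠ i → lorentz x.toMink (P.normal j) < 0 := by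
    intro j
    by_cases hj : j = i
    · obtain ⟨x, hx⟩ := P.facet_nonempty hn i
      exact ⟨x, hx, fun h => absurd hj h⟩
    · by_contra! h
      refine P.not_ker_le_ker (Ne.symm hj) ?_
      rw [← span_facet, Submodule.span_le]
      rintro _ ⟨x, hx, rfl⟩
      exact le_antisymm (hx.1 j) (h x hx).2
  choose x hx hxj using h1
  refine ⟨∑ j, (x j).toMink, ?_, ?_, ?_⟩
  · exact Finset.sum_induction_nonempty _ IsFuture (fun _ _ => IsFuture.add)
      ⟨i, Finset.mem_univ i⟩ (fun j _ => (x j).isFuture)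
  · rw [lorentz_sum_left]
    exact Finset.sum_eq_zero fun j _ => (hx j).2
  · intro j hj
    rw [lorentz_sum_left]
    exact Finset.sum_neg' (fun k _ => (hx k).1 j) ⟨j, Finset.mem_univ j, hxj j hj⟩

/-- The relative interior of a facet is not covered by finitely many proper subspaces. -/
theorem exists_relint_notMem (hn : 2 ≤ n) (i : ι) {κ : Type*} [Finite κ]
    (U : κ → Submodule ℝ (Minkowski n))
    (hU : ∀ k, ¬ LinearMap.ker (lorentzDual (P.normal i)) ≤ U k) :
    ∃ p, IsFuture p ∧ lorentz p (P.normal i) = 0 ∧ (∀ j, j ≠ i → lorentz p (P.normal j) < 0) ∧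
      ∀ k, p ∉ U k := by
  have := P.finite
  obtain ⟨p, hp, hpi, hpj⟩ := P.exists_relint hn i
  obtain ⟨q, hq, hqU⟩ := Submodule.exists_mem_forall_notMem _ U hU
  have hc : Continuous fun t : ℝ => p + t • q := by fun_prop
  have h1 : ∀ᶠ t : ℝ in 𝓝 0, IsFuture (p + t • q) :=
    (isOpen_isFuture.preimage hc).mem_nhds (by simpa using hp)
  have h2 : ∀ᶠ t : ℝ in 𝓝 0, ∀ j, j ≠ i → lorentz (p + t • q) (P.normal j) < 0 := by
    rw [eventually_all]
    intro j
    by_cases hj : j = i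
    · simp [hj]
    · have : IsOpen {t : ℝ | lorentz (p + t • q) (P.normal j) < 0} :=
        isOpen_lt (hc.lorentz continuous_const) continuous_const
      filter_upwards [this.mem_nhds (by simpa using hpj j hj)] with t ht _ using ht
  have h3 : ∀ᶠ t : ℝ in 𝓝[≠] 0, ∀ k, p + t • q ∉ U k := by
    rw [eventually_all]
    intro k
    -- The direction `q` avoids `U k`, so the line through `p` meets `U k` at most once, and small
    -- nonzero `t` avoid every `U k`.
    have hs : {t : ℝ | p + t • q ∈ U k}.Subsingleton := by
      intro s hs t ht
      by_contra hst
      have h4 := (U k).sub_mem hs ht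
      have h5 : p + s • q - (p + t • q) = (s - t) • q := by module
      rw [h5, (U k).smul_mem_iff (sub_ne_zero.2 hst)] at h4
      exact hqU k h4
    have h6 : {t : ℝ | p + t • q ∈ U k}ᶜ ∪ {0} ∈ 𝓝 (0 : ℝ) := by
      have : IsClosed ({t : ℝ | p + t • q ∈ U k} \ {0}) := (hs.finite.sdiff).isClosed
      have h7 := this.isOpen_compl.mem_nhds (x := (0 : ℝ)) (by simp)
      rwa [Set.compl_sdiff, Set.union_comm] at h7
    rw [eventually_nhdsWithin_iff]
    filter_upwards [h6] with t ht ht0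
    rcases ht with ht | ht
    · exact ht
    · exact absurd ht ht0
  obtain ⟨t, ⟨ht1, ht2⟩, ht3⟩ := (((h1.and h2).filter_mono nhdsWithin_le_nhds).and h3).exists
  refine ⟨_, ht1, ?_, ht2, ht3⟩
  rw [lorentz_add_left, lorentz_smul_left, hpi, mem_ker_lorentzDual.1 hq]; ring

/-- A facet is cut out of its hyperplane by the adjacent facets. -/
theorem mem_of_adjacent (hn : 2 ≤ n) {i : ι} {y : Minkowski n} (hy : IsFuture y)
    (hyi : lorentz y (P.normal i) = 0) (h : ∀ j, P.Adjacent i j → lorentz y (P.normal j) ≤ 0)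
    (k : ι) : lorentz y (P.normal k) ≤ 0 := by
  classical
  have := P.finite
  cases nonempty_fintype ι
  by_contra! hk
  -- For `j` not adjacent to `i` the intersection of the facets spans dimension at most `n - 2`;
  -- adjoining `y` still leaves a proper subspace of the hyperplane. A point `p` outside all of
  -- these sees `y` along a segment that misses the non-adjacent facets.
  let U : {j // j ≠ i ∧ ¬ P.Adjacent i j} → Submodule ℝ (Minkowski n) := fun j =>
    Submodule.span ℝ (Hyp.toMink '' (P.facet i ∩ P.facet j)) ⊔ Submodule.span ℝ {y}
  have hU : ∀ j, ¬ LinearMap.ker (lorentzDual (P.normal i)) ≤ U j := by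
    rintro ⟨j, hji, hj⟩ hle
    have h1 := Submodule.finrank_mono hle
    rw [finrank_ker_lorentzDual (P.normal_unit i)] at h1
    have h2 := Submodule.finrank_add_le_finrank_add_finrank
      (Submodule.span ℝ (Hyp.toMink '' (P.facet i ∩ P.facet j))) (Submodule.span ℝ {y})
    have h3 := finrank_span_le_card (R := ℝ) ({y} : Set (Minkowski n))
    have h4 := P.finrank_span_facet_inter_lt (Ne.symm hji) hj
    rw [Set.toFinset_singleton, Finset.card_singleton] at h3
    simp only [U] at h1
    omega
  obtain ⟨p, hp, hpi, hpj, hpU⟩ := P.exists_relint_notMem hn i U hU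
  have hki : k ≠ i := by
    rintro rfl
    exact hk.ne' hyi
  -- The ratio is the value of `r` at which `r • p + y` meets the wall `j`. The largest one belongs
  -- to the wall through which the segment from `p` to `y` leaves the facet.
  obtain ⟨l, hl, hmax⟩ := Finset.exists_max_image (Finset.univ.filter (· ≠ i))
    (fun j => lorentz y (P.normal j) / (-lorentz p (P.normal j)))
    ⟨k, by simpa using hki⟩
  simp only [Finset.mem_filter, Finset.mem_univ, true_and] at hl hmax
  set r := lorentz y (P.normal l) / (-lorentz p (P.normal l)) with hr
  have hr0 : 0 < r := lt_of_lt_of_le (div_pos hk (by linarith [hpj k hki])) (hmax k hki)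
  have hyl : lorentz y (P.normal l) = r * -lorentz p (P.normal l) := by
    rw [hr, div_mul_cancel₀]
    linarith [hpj l hl]
  have hlna : ¬ P.Adjacent i l := by
    intro hadj
    have := h l hadj
    have := mul_pos hr0 (neg_pos.2 (hpj l hl))
    linarith
  have hz : IsFuture (r • p + y) := (hp.smul hr0).add hy
  obtain ⟨x, hx, c, hc, hxz⟩ := P.exists_mem_carrier hz (fun j => by
    rw [lorentz_add_left, lorentz_smul_left]
    by_cases hj : j = i
    · rw [hj, hpi, hyi]; simp
    · have h5 := hmax j hj
      rw [div_le_iff₀ (by linarith [hpj j hj])] at h5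
      linarith)
  have hxl : x ∈ P.facet i ∩ P.facet l := by
    refine ⟨⟨hx, ?_⟩, hx, ?_⟩ <;> rw [hxz, lorentz_smul_left, lorentz_add_left, lorentz_smul_left]
    · rw [hpi, hyi]; ring
    · rw [hyl]; ring
  apply hpU ⟨l, hl, hlna⟩
  have h6 : x.toMink ∈ U ⟨l, hl, hlna⟩ :=
    Submodule.mem_sup_left (Submodule.subset_span ⟨x, hxl, rfl⟩)
  have h7 : y ∈ U ⟨l, hl, hlna⟩ :=
    Submodule.mem_sup_right (Submodule.mem_span_singleton_self y)
  -- The exit point `x` lies on both facets, so `p` would lie in the subspace that it was chosen to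
  -- avoid.
  have h8 : p = r⁻¹ • (c⁻¹ • x.toMink - y) := by
    rw [hxz, inv_smul_smul₀ hc.ne', add_sub_cancel_right, inv_smul_smul₀ hr0.ne']
  rw [h8]
  exact Submodule.smul_mem _ _ (Submodule.sub_mem _ (Submodule.smul_mem _ _ h6) h7)

end HypPolytope

/-! ### Products of the normals of a right-angled polytope -/

namespace RightAngledPolytope

variable {n : ℕ} {ι : Type*} (P : RightAngledPolytope n ι)

/-- Project a relatively interior point `p` of facet `k` orthogonally to the hyperplane of `i`. By
the right angles this does not change the products with the normals adjacent to `i`, so the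
projection lies in facet `i`; its inequality for `k` is the claim, since `⟨p, normal i⟩ < 0`. -/
theorem lorentz_normal_nonpos (hn : 2 ≤ n) {i k : ι} (hik : i ≠ k) :
    lorentz (P.normal i) (P.normal k) ≤ 0 := by
  obtain ⟨p, hp, hpk, hpj⟩ := P.exists_relint hn k
  have hpi := hpj i hik
  set y := p - lorentz p (P.normal i) • P.normal i with hy
  have hyi : lorentz y (P.normal i) = 0 := by
    rw [hy, lorentz_sub_smul_left, P.normal_unit]; ring
  have hyy : lorentz y y = lorentz p p - lorentz p (P.normal i) ^ 2 := by
    rw [hy, lorentz_sub_smul_right, ← hy, hyi, hy, lorentz_sub_smul_left,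
      lorentz_comm (P.normal i)]; ring
  have hpy : lorentz p y = lorentz p p - lorentz p (P.normal i) ^ 2 := by
    rw [hy, lorentz_sub_smul_right]; ring
  have hneg : lorentz p p - lorentz p (P.normal i) ^ 2 < 0 := by
    nlinarith [hp.1, sq_nonneg (lorentz p (P.normal i))]
  have hyf : IsFuture y := hp.of_lorentz_neg (hyy.trans_lt hneg) (hpy.trans_lt hneg)
  have h1 := P.mem_of_adjacent hn hyf hyi (fun j hj => by
    rw [hy, lorentz_sub_smul_left, P.right_angled i j hj]
    by_cases hjk : j = k
    · rw [hjk, hpk]; simp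
    · linarith [hpj j hjk]) k
  rw [hy, lorentz_sub_smul_left, hpk] at h1
  nlinarith

/-- If the hyperplanes of two facets intersect, then the facets are adjacent. -/
theorem adjacent_of_neg_one_lt (hn : 2 ≤ n) {i k : ι} (hik : i ≠ k)
    (h : -1 < lorentz (P.normal i) (P.normal k)) : P.Adjacent i k := by
  refine ⟨hik, ?_⟩
  refine Eq.trans (congrArg (· + 1) ?_) (P.finrank_ker_inf_ker hik)
  refine le_antisymm (Submodule.finrank_mono (P.span_facet_inter_le i k))
    (Submodule.finrank_mono ?_)
  have hg := P.lorentz_normal_nonpos hn hik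
  set g := lorentz (P.normal i) (P.normal k) with hgdef
  have hg2 : 0 < 1 - g ^ 2 := by nlinarith
  have hki : lorentz (P.normal k) (P.normal i) = g := lorentz_comm _ _
  -- `α` and `β` solve the `2 × 2` Gram system, which is invertible because `g² < 1`; `π` is the
  -- orthogonal projection to the intersection of the two hyperplanes.
  let α : Minkowski n → ℝ := fun z =>
    (lorentz z (P.normal i) - g * lorentz z (P.normal k)) / (1 - g ^ 2)
  let β : Minkowski n → ℝ := fun z =>
    (lorentz z (P.normal k) - g * lorentz z (P.normal i)) / (1 - g ^ 2)
  let π : Minkowski n → Minkowski n := fun z => z - (α z • P.normal i + β z • P.normal k)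
  have hα : ∀ z, α z + g * β z = lorentz z (P.normal i) := by
    intro z; simp only [α, β]; field_simp; ring
  have hβ : ∀ z, g * α z + β z = lorentz z (P.normal k) := by
    intro z; simp only [α, β]; field_simp; ring
  have hπ : ∀ z w, lorentz (π z) w =
      lorentz z w - (α z * lorentz (P.normal i) w + β z * lorentz (P.normal k) w) := by
    intro z w
    simp only [π, sub_eq_add_neg, lorentz_add_left, lorentz_neg_left, lorentz_smul_left]
  have hπi : ∀ z, lorentz (π z) (P.normal i) = 0 := by
    intro z; rw [hπ, P.normal_unit, hki]; linarith [hα z]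
  have hπk : ∀ z, lorentz (π z) (P.normal k) = 0 := by
    intro z; rw [hπ, P.normal_unit, ← hgdef]; linarith [hβ z]
  -- Both coefficients are nonpositive, as are the products of distinct normals, so `π` preserves
  -- the inequalities of the polytope. The part removed has nonnegative square, so `π z` stays
  -- timelike.
  have hmem : ∀ z, IsFuture z → (∀ j, lorentz z (P.normal j) ≤ 0) →
      π z ∈ Submodule.span ℝ (Hyp.toMink '' (P.facet i ∩ P.facet k)) := by
    intro z hz hzj
    have hα0 : α z ≤ 0 := div_nonpos_of_nonpos_of_nonneg (by nlinarith [hzj i, hzj k]) hg2.le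
    have hβ0 : β z ≤ 0 := div_nonpos_of_nonpos_of_nonneg (by nlinarith [hzj i, hzj k]) hg2.le
    have h1 : lorentz (π z) z = lorentz z z - (α z ^ 2 + β z ^ 2 + 2 * g * α z * β z) := by
      rw [hπ, lorentz_comm (P.normal i) z, lorentz_comm (P.normal k) z, ← hα, ← hβ]
      ring
    have h2 : lorentz (π z) (π z) = lorentz (π z) z := by
      conv_lhs => rw [lorentz_comm, hπ]
      rw [lorentz_comm z, lorentz_comm _ (π z), lorentz_comm _ (π z), hπi, hπk]; ring
    have h3 : 0 ≤ α z ^ 2 + β z ^ 2 + 2 * g * α z * β z := by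
      nlinarith [sq_nonneg (α z - β z), mul_nonneg_of_nonpos_of_nonpos hα0 hβ0]
    have h4 : lorentz (π z) z < 0 := by linarith [hz.1]
    have h5 : IsFuture (π z) := hz.of_lorentz_neg (h2.trans_lt h4) (by rwa [lorentz_comm])
    obtain ⟨x, hx, c, hc, hxz⟩ := P.exists_mem_carrier h5 (fun j => by
      by_cases hji : j = i
      · rw [hji, hπi]
      by_cases hjk : j = k
      · rw [hjk, hπk]
      rw [hπ]
      nlinarith [hzj j, P.lorentz_normal_nonpos hn (Ne.symm hji),
        P.lorentz_normal_nonpos hn (Ne.symm hjk)])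
    have hxm : x ∈ P.facet i ∩ P.facet k := by
      refine ⟨⟨hx, ?_⟩, hx, ?_⟩ <;> rw [hxz, lorentz_smul_left]
      · rw [hπi, mul_zero]
      · rw [hπk, mul_zero]
    have h6 : π z = c⁻¹ • x.toMink := by rw [hxz, inv_smul_smul₀ hc.ne']
    rw [h6]
    exact Submodule.smul_mem _ _ (Submodule.subset_span ⟨x, hxm, rfl⟩)
  intro w hw
  have hwi : lorentz w (P.normal i) = 0 := hw.1
  have hwk : lorentz w (P.normal k) = 0 := hw.2
  have hπw : π w = w := by simp [π, α, β, hwi, hwk]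
  -- Moving an interior point slightly along `w` keeps it in the cone of the polytope, and `π` fixes
  -- `w`; the difference of the two projections is a nonzero multiple of `w`.
  obtain ⟨x, hx⟩ := P.exists_interior
  have := P.finite
  have hc : Continuous fun t : ℝ => x.toMink + t • w := by fun_prop
  have h1 : ∀ᶠ t : ℝ in 𝓝 0, IsFuture (x.toMink + t • w) :=
    (isOpen_isFuture.preimage hc).mem_nhds (by simpa [Hyp.toMink] using x.isFuture)
  have h2 : ∀ᶠ t : ℝ in 𝓝 0, ∀ j, lorentz (x.toMink + t • w) (P.normal j) ≤ 0 := by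
    rw [eventually_all]
    intro j
    have : IsOpen {t : ℝ | lorentz (x.toMink + t • w) (P.normal j) < 0} :=
      isOpen_lt (hc.lorentz continuous_const) continuous_const
    filter_upwards [this.mem_nhds (by simpa using hx j)] with t ht using le_of_lt ht
  obtain ⟨t, ⟨ht1, ht2⟩, ht0⟩ :=
    (((h1.and h2).filter_mono nhdsWithin_le_nhds).and (self_mem_nhdsWithin (s := {(0 : ℝ)}ᶜ))).exists
  have h3 := hmem _ ht1 ht2
  have h4 := hmem _ x.isFuture (fun j => (hx j).le)
  have h5 : π (x.toMink + t • w) = π x.toMink + t • w := by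
    simp only [π, α, β, lorentz_add_left, lorentz_smul_left, hwi, hwk, mul_zero, add_zero]
    abel
  rw [h5] at h3
  have h6 := Submodule.sub_mem _ h3 h4
  rw [show π x.toMink + t • w - π x.1 = t • w from add_sub_cancel_left _ _,
    Submodule.smul_mem_iff _ ht0] at h6
  exact h6

theorem lorentz_normal_le_neg_one (hn : 2 ≤ n) {i k : ι} (hik : i ≠ k) (h : ¬ P.Adjacent i k) :
    lorentz (P.normal i) (P.normal k) ≤ -1 := by
  by_contra! h1
  exact h (P.adjacent_of_neg_one_lt hn hik h1)

/-- Facets with a common point are adjacent. -/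
theorem adjacent_of_mem (hn : 2 ≤ n) {i k : ι} (hik : i ≠ k) {x : Hyp n} (hi : x ∈ P.facet i)
    (hk : x ∈ P.facet k) : P.Adjacent i k := by
  by_contra h
  have h1 := P.lorentz_normal_le_neg_one hn hik h
  -- The sum of the normals is orthogonal to `x`, hence spacelike, whereas its square `2 + 2g` is
  -- nonpositive if `g ≤ -1`.
  have h2 : lorentz x.1 (P.normal i + P.normal k) = 0 := by
    rw [lorentz_add_right]
    linarith [show lorentz x.1 (P.normal i) = 0 from hi.2,
      show lorentz x.1 (P.normal k) = 0 from hk.2]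
  have h3 := x.isFuture.lorentz_pos_of_orthogonal h2 (P.normal_add_ne_zero i k)
  rw [lorentz_add_left, lorentz_add_right, lorentz_add_right, P.normal_unit, P.normal_unit,
    lorentz_comm (P.normal k)] at h3
  linarith

end RightAngledPolytope

/-! ### Linear reflections, and vertices on the faces -/

/-- The reflection in the hyperplane orthogonal to a unit vector, as a linear automorphism. -/
def lorentzReflectEquiv {n : ℕ} (e : Minkowski n) (he : lorentz e e = 1) :
    Minkowski n ≃ₗ[ℝ] Minkowski n :=
  LinearEquiv.ofInvolutive
    { toFun := lorentzReflect e
      map_add' := fun x y => by simp only [lorentzReflect, lorentz_add_left]; module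
      map_smul' := fun c x => by
        simp only [lorentzReflect, lorentz_smul_left, RingHom.id_apply]; module }
    (lorentzReflect_involutive he)

/-- Take `v` with a maximal set of facets containing those through `x`. If another point lay on all
facets through `v`, the geodesic towards it would have to leave the compact polytope, and the first
new facet that it hits would contradict maximality. -/
theorem HypPolytope.exists_isVertex {n : ℕ} {ι : Type*} (P : HypPolytope n ι) {x : Hyp n}
    (hx : x ∈ P.carrier) : ∃ v, P.IsVertex v ∧ ∀ i, x ∈ P.facet i → v ∈ P.facet i := by
  have := P.finite
  obtain ⟨S, hS, ⟨⟨v, hv, rfl⟩, hmax⟩⟩ := (Set.toFinite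
    {S : Set ι | ∃ v ∈ P.carrier, {i | v ∈ P.facet i} = S}).exists_le_maximal
      (show {i | x ∈ P.facet i} ∈ _ from ⟨x, hx, rfl⟩)
  refine ⟨v, ⟨hv, fun y hy hvy => ?_⟩, fun i hi => hS hi⟩
  by_contra hne
  have ha := Hyp.lorentz_lt_neg_one (Ne.symm hne)
  set a := lorentz v.1 y.1 with ha_def
  have ha2 : 0 < a ^ 2 - 1 := by nlinarith
  have hs := Real.sqrt_pos.2 ha2
  set u : Minkowski n := (√(a ^ 2 - 1))⁻¹ • (y.1 + a • v.1) with hu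
  have hvv : lorentz v.1 v.1 = -1 := v.2.1
  have hyv : lorentz y.1 v.1 = a := lorentz_comm _ _
  have hvu : lorentz v.1 u = 0 := by
    rw [hu, lorentz_smul_right, lorentz_add_right, lorentz_smul_right, hvv, ← ha_def]; ring
  have huu : lorentz u u = 1 := by
    have h1 : lorentz (y.1 + a • v.1) (y.1 + a • v.1) = a ^ 2 - 1 := by
      simp only [lorentz_add_left, lorentz_add_right, lorentz_smul_left, lorentz_smul_right, hvv,
        hyv, y.2.1, ← ha_def]
      ring
    rw [hu, lorentz_smul_left, lorentz_smul_right, h1]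
    have := Real.mul_self_sqrt ha2.le
    field_simp
    rw [pow_two (√_), this]
  let γ : ℝ → Minkowski n := fun t => Real.cosh t • v.1 + Real.sinh t • u
  have hγv : ∀ t, lorentz v.1 (γ t) = -Real.cosh t := by
    intro t
    simp only [γ, lorentz_add_right, lorentz_smul_right, hvv, hvu]; ring
  have hγ : ∀ t, lorentz (γ t) (γ t) = -1 := by
    intro t
    simp only [γ, lorentz_add_left, lorentz_add_right, lorentz_smul_left, lorentz_smul_right, hvv,
      hvu, huu, lorentz_comm u v.1]
    linarith [Real.cosh_sq t]
  have hγm : ∀ t, lorentz (γ t) (γ t) = -1 ∧ 0 < (γ t).1 := fun t =>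
    ⟨hγ t, (v.isFuture.of_lorentz_neg (by rw [hγ]; norm_num)
      (by rw [hγv]; linarith [Real.cosh_pos t])).2⟩
  have hγc : Continuous γ := by
    have := Real.continuous_cosh
    have := Real.continuous_sinh
    fun_prop
  have hγi : ∀ i, v ∈ P.facet i → ∀ t, lorentz (γ t) (P.normal i) = 0 := by
    intro i hi t
    have h1 : lorentz v.1 (P.normal i) = 0 := hi.2
    have h2 : lorentz y.1 (P.normal i) = 0 := (hvy i hi).2
    simp only [γ, hu, lorentz_add_left, lorentz_smul_left, h1, h2]; ring
  have hγ0 : ∀ i, v ∉ P.facet i → lorentz (γ 0) (P.normal i) < 0 := by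
    intro i hi
    have h1 : γ 0 = v.1 := by simp [γ]
    rw [h1]
    exact lt_of_le_of_ne (hv i) fun h => hi ⟨hv, h⟩
  obtain ⟨R, hR⟩ := P.isCompact.bddAbove_image (f := fun z : Hyp n => -lorentz v.1 z.1)
    (by fun_prop)
  -- At this time `cosh t₁ > t₁ ≥ R`, so the geodesic has left the polytope; the maximum with `0`
  -- makes `[0, t₁]` nonempty.
  set t₁ := max R 0 with ht₁
  have h1 : ∃ i, 0 < lorentz (γ t₁) (P.normal i) := by
    by_contra! h
    have h2 : -lorentz v.1 (γ t₁) ≤ R := hR ⟨⟨γ t₁, hγm t₁⟩, h, rfl⟩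
    rw [hγv, neg_neg] at h2
    have h3 : t₁ ≤ Real.sinh t₁ := Real.self_le_sinh_iff.2 (le_max_right _ _)
    linarith [Real.sinh_lt_cosh t₁, le_max_left R 0]
  have hcont : ∀ i, Continuous fun t => lorentz (γ t) (P.normal i) := fun i =>
    hγc.lorentz continuous_const
  have hivt : ∀ i, v ∉ P.facet i → ∀ t, 0 ≤ t → 0 < lorentz (γ t) (P.normal i) →
      ∃ s ∈ Set.Icc 0 t, lorentz (γ s) (P.normal i) = 0 := fun i hi t ht hpos =>
    intermediate_value_Icc ht (hcont i).continuousOn ⟨(hγ0 i hi).le, hpos.le⟩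
  let A : Set ℝ := Set.Icc 0 t₁ ∩ ⋃ i ∈ {i | v ∉ P.facet i}, {t | lorentz (γ t) (P.normal i) = 0}
  have hA : IsCompact A := isCompact_Icc.inter_right
    ((Set.toFinite _).isClosed_biUnion fun i _ => isClosed_eq (hcont i) continuous_const)
  have hAne : A.Nonempty := by
    obtain ⟨i, hi⟩ := h1
    have hvi : v ∉ P.facet i := fun h => hi.ne' (hγi i h _)
    obtain ⟨s, hs, hs0⟩ := hivt i hvi t₁ (le_max_right _ _) hi
    exact ⟨s, hs, Set.mem_biUnion hvi hs0⟩
  obtain ⟨t, ⟨htI, htU⟩, htmin⟩ := hA.exists_isLeast hAne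
  obtain ⟨i, hvi, hti⟩ := Set.mem_iUnion₂.1 htU
  have hw : (⟨γ t, hγm t⟩ : Hyp n) ∈ P.carrier := by
    intro j
    by_cases hj : v ∈ P.facet j
    · exact (hγi j hj t).le
    · by_contra! hpos
      obtain ⟨s, hs, hs0⟩ := hivt j hj t htI.1 hpos
      have := htmin ⟨⟨hs.1, hs.2.trans htI.2⟩, Set.mem_biUnion hj hs0⟩
      rw [le_antisymm hs.2 this] at hs0
      exact hpos.ne' hs0
  exact hvi (hmax ⟨_, hw, rfl⟩ (fun j hj => ⟨hw, hγi j hj t⟩) (show i ∈ {i | _} from ⟨hw, hti⟩))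

/-! ### The Coxeter group: walls, fundamental domain, stabilisers -/

namespace RightAngledPolytope

variable {n : ℕ} {ι : Type*} (P : RightAngledPolytope n ι)

/-- The Coxeter system of a right-angled polytope. -/
def system : CoxeterSystem P.coxeterMatrix P.CoxeterGroup := P.coxeterMatrix.toCoxeterSystem

theorem system_simple (i : ι) : P.system.simple i = P.gen i := rfl

theorem gen_mul_gen_self (i : ι) : P.gen i * P.gen i = 1 := P.system.simple_mul_simple_self i

theorem inv_gen (i : ι) : (P.gen i)⁻¹ = P.gen i := P.system.inv_simple i

theorem gen_commute {i j : ι} (h : P.Adjacent i j) : Commute (P.gen i) (P.gen j) := by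
  have h1 := P.system.simple_mul_simple_pow i j
  have h2 : P.coxeterMatrix i j = 2 := by
    simp [coxeterMatrix, h.1, h]
  rw [h2, system_simple, system_simple, pow_two] at h1
  have h3 := eq_inv_of_mul_eq_one_left h1
  rwa [mul_inv_rev, inv_gen, inv_gen] at h3

theorem gen_induction {p : P.CoxeterGroup → Prop} (w : P.CoxeterGroup) (one : p 1)
    (mul : ∀ i w, p w → p (P.gen i * w)) : p w :=
  P.system.simple_induction_left w one fun w i => mul i w

/-- The linear action of the Coxeter group on Minkowski space. -/
def linAction : P.CoxeterGroup →* (Minkowski n ≃ₗ[ℝ] Minkowski n) :=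
  P.liftHom (fun F => lorentzReflectEquiv (P.normal F) (P.normal_unit F))
    (fun F => LinearEquiv.ext (lorentzReflect_involutive (P.normal_unit F)))
    (fun F G h => LinearEquiv.ext (lorentzReflect_commute (P.right_angled F G h)))

theorem linAction_gen (i : ι) (x : Minkowski n) :
    P.linAction (P.gen i) x = lorentzReflect (P.normal i) x := by
  rw [linAction, liftHom_gen]; rfl

theorem linAction_mul (v w : P.CoxeterGroup) (x : Minkowski n) :
    P.linAction (v * w) x = P.linAction v (P.linAction w x) := by
  rw [map_mul]; rfl

theorem gen_smul (i : ι) (x : Hyp n) :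
    ((P.gen i • x : Hyp n) : Minkowski n) = lorentzReflect (P.normal i) x.1 := by
  have : P.gen i • x = P.action (P.gen i) x := rfl
  rw [this, action, liftHom_gen]; rfl

theorem coe_smul (w : P.CoxeterGroup) (x : Hyp n) :
    ((w • x : Hyp n) : Minkowski n) = P.linAction w x.1 := by
  induction w using P.gen_induction with
  | one => rw [one_smul, map_one]; rfl
  | mul i w ih => rw [mul_smul, gen_smul, ih, linAction_mul, linAction_gen]

theorem lorentz_linAction (w : P.CoxeterGroup) (x y : Minkowski n) :
    lorentz (P.linAction w x) (P.linAction w y) = lorentz x y := by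
  induction w using P.gen_induction with
  | one => rw [map_one]; rfl
  | mul i w ih =>
    rw [linAction_mul, linAction_mul, linAction_gen, linAction_gen,
      lorentz_reflect_reflect (P.normal_unit i), ih]

theorem lorentz_smul_smul (w : P.CoxeterGroup) (x y : Hyp n) :
    lorentz (w • x : Hyp n).1 (w • y : Hyp n).1 = lorentz x.1 y.1 := by
  rw [coe_smul, coe_smul, lorentz_linAction]

instance : ContinuousConstSMul P.CoxeterGroup (Hyp n) where
  continuous_const_smul w := by
    have h : Continuous fun x : Hyp n => P.linAction w x.1 :=
      (LinearMap.continuous_of_finiteDimensional (P.linAction w).toLinearMap).comp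
        continuous_subtype_val
    refine continuous_induced_rng.2 (h.congr fun x => (P.coe_smul w x).symm)

/-- The half-space `⟨·, u⟩ ≤ 0` contains the polytope. -/
def Supports (u : Minkowski n) : Prop := ∀ x ∈ P.carrier, lorentz x.1 u ≤ 0

variable {P} in
theorem Supports.add {u v : Minkowski n} (hu : P.Supports u) (hv : P.Supports v) :
    P.Supports (u + v) := fun x hx => by
  rw [lorentz_add_right]; linarith [hu x hx, hv x hx]

variable {P} in
theorem Supports.smul {u : Minkowski n} (hu : P.Supports u) {c : ℝ} (hc : 0 ≤ c) :
    P.Supports (c • u) := fun x hx => by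
  rw [lorentz_smul_right]; exact mul_nonpos_of_nonneg_of_nonpos hc (hu x hx)

/-- The second clause strengthens the induction for pairs of non-adjacent facets, where the two
reflections generate no finite group. A positive combination of supporting vectors supports, so
every case is reduced to the shorter element `w * gen j`, for which `j` is no descent. -/
theorem supports_aux (hn : 2 ≤ n) (N : ℕ) : ∀ w : P.CoxeterGroup, P.system.length w = N →
    (∀ i, ¬ P.system.IsRightDescent w i → P.Supports (P.linAction w (P.normal i))) ∧
    (∀ i j, i ≠ j → ¬ P.Adjacent i j → P.system.IsRightDescent w j →
      P.Supports (P.linAction w (P.normal i + P.normal j))) := by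
  induction N using Nat.strong_induction_on with
  | _ N ih =>
  intro w hw
  have key : ∀ j, P.system.IsRightDescent w j →
      P.Supports (P.linAction (w * P.gen j) (P.normal j)) ∧
      P.system.length (w * P.gen j) < N := by
    intro j hj
    have h1 : P.system.length (w * P.gen j) < N := hw ▸ hj
    exact ⟨(ih _ h1 _ rfl).1 j
      (P.system.isRightDescent_iff_not_isRightDescent_mul.1 hj), h1⟩
  have hw' : ∀ j x, P.linAction w x =
      P.linAction (w * P.gen j) (lorentzReflect (P.normal j) x) := by
    intro j x
    rw [linAction_mul, linAction_gen, lorentzReflect_involutive (P.normal_unit j)]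
  have hneg : ∀ j, P.linAction (w * P.gen j) (P.normal j) = -P.linAction w (P.normal j) := by
    intro j
    rw [linAction_mul, linAction_gen, ← map_neg]
    congr 1
    rw [lorentzReflect, P.normal_unit]; module
  have h2 : ∀ i j, i ≠ j → ¬ P.Adjacent i j → P.system.IsRightDescent w j →
      P.Supports (P.linAction w (P.normal i + P.normal j)) := by
    intro i j hij hadj hj
    obtain ⟨h1, hlt⟩ := key j hj
    have hg := P.lorentz_normal_le_neg_one hn hij hadj
    set g := lorentz (P.normal i) (P.normal j) with hgdef
    by_cases hi : P.system.IsRightDescent (w * P.gen j) i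
    · have h3 := (ih _ hlt _ rfl).2 j i hij.symm (fun h => hadj h.symm) hi
      -- The reflection sends `e_i + e_j` to `e_i + (-2g - 1) e_j`. Here `e_i + e_j` is already
      -- available, which leaves the coefficient `-2g - 2 ≥ 0`; in the other case `e_i` alone is
      -- available.
      have h4 := h3.add (h1.smul (c := -2 * g - 2) (by linarith))
      rw [← map_smul, ← map_add] at h4
      rw [hw' j]
      convert h4 using 2
      rw [lorentzReflect, lorentz_add_left, P.normal_unit, ← hgdef]; module
    · have h3 := (ih _ hlt _ rfl).1 i hi
      have h4 := h3.add (h1.smul (c := -2 * g - 1) (by linarith))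
      rw [← map_smul, ← map_add] at h4
      rw [hw' j]
      convert h4 using 2
      rw [lorentzReflect, lorentz_add_left, P.normal_unit, ← hgdef]; module
  refine ⟨fun i hi => ?_, h2⟩
  rcases eq_or_ne w 1 with rfl | hw1
  · rw [map_one]
    exact fun x hx => hx i
  obtain ⟨j, hj⟩ := P.system.exists_rightDescent_of_ne_one hw1
  have hij : i ≠ j := by rintro rfl; exact hi hj
  obtain ⟨h1, hlt⟩ := key j hj
  by_cases hadj : P.Adjacent i j
  · have h3 : ¬ P.system.IsRightDescent (w * P.gen j) i := by
      intro h
      have h4 : w * P.gen i = w * P.gen j * P.gen i * P.gen j := by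
        rw [mul_assoc _ (P.gen i), (P.gen_commute hadj).eq, ← mul_assoc, mul_assoc w,
          P.gen_mul_gen_self, mul_one]
      have h5 := P.system.length_mul_le (w * P.gen j * P.gen i) (P.gen j)
      rw [← h4, ← P.system_simple j, P.system.length_simple] at h5
      have h6 := (P.system.not_isRightDescent_iff).1 hi
      rw [system_simple] at h6
      unfold CoxeterSystem.IsRightDescent at h
      rw [system_simple] at h h5
      omega
    have h4 := (ih _ hlt _ rfl).1 i h3
    rw [hw' j]
    convert h4 using 2
    rw [lorentzReflect, P.right_angled i j hadj]; module
  · have h3 := (h2 i j hij hadj hj).add h1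
    rw [hneg, map_add, add_neg_cancel_right] at h3
    exact h3

/-- No wall of the tiling cuts the polytope. -/
theorem supports_linAction (hn : 2 ≤ n) {w : P.CoxeterGroup} {i : ι}
    (h : ¬ P.system.IsRightDescent w i) : P.Supports (P.linAction w (P.normal i)) :=
  (P.supports_aux hn _ w rfl).1 i h

/-- The polytope is a strict fundamental domain, and stabilisers are generated by reflections in
facets. -/
theorem eq_and_mem_closure_of_smul_mem (hn : 2 ≤ n) {x : Hyp n} (hx : x ∈ P.carrier)
    (w : P.CoxeterGroup) (hw : w • x ∈ P.carrier) :
    w • x = x ∧ w ∈ Subgroup.closure (P.gen '' {i | x ∈ P.facet i}) := by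
  induction hN : P.system.length w using Nat.strong_induction_on generalizing w with
  | _ N ih =>
  rcases eq_or_ne w 1 with rfl | hw1
  · exact ⟨one_smul _ _, one_mem _⟩
  obtain ⟨i, hi⟩ := P.system.exists_rightDescent_of_ne_one hw1
  -- Evaluated at `w • x`, this says `-⟨x, normal i⟩ ≤ 0`. So `x` lies on facet `i`, and the last
  -- letter of `w` fixes it.
  have h1 := P.supports_linAction hn (P.system.isRightDescent_iff_not_isRightDescent_mul.1 hi)
    _ hw
  rw [system_simple, linAction_mul, coe_smul, lorentz_linAction, linAction_gen, lorentzReflect,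
    P.normal_unit, lorentz_sub_smul_right] at h1
  have h2 : lorentz x.1 (P.normal i) = 0 := le_antisymm (hx i) (by linarith)
  have h3 : P.gen i • x = x := by
    apply Subtype.ext
    rw [gen_smul, lorentzReflect, h2]; simp
  have h4 : w * P.gen i * P.gen i = w := by rw [mul_assoc, gen_mul_gen_self, mul_one]
  have h5 : (w * P.gen i) • x = w • x := by rw [mul_smul, h3]
  obtain ⟨h6, h7⟩ := ih _ (hN ▸ hi) (w * P.gen i) (by rwa [h5]) rfl
  refine ⟨h5 ▸ h6, ?_⟩
  rw [← h4]
  exact mul_mem h7 (Subgroup.subset_closure ⟨i, ⟨hx, h2⟩, rfl⟩)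

theorem eq_one_of_smul_mem (hn : 2 ≤ n) {x : Hyp n}
    (hx : ∀ i, lorentz x.toMink (P.normal i) < 0) {w : P.CoxeterGroup}
    (hw : w • x ∈ P.carrier) : w = 1 := by
  have h := (P.eq_and_mem_closure_of_smul_mem hn (fun i => (hx i).le) w hw).2
  have h1 : {i | x ∈ P.facet i} = ∅ :=
    Set.eq_empty_of_forall_notMem fun i hi => (hx i).ne hi.2
  rwa [h1, Set.image_empty, Subgroup.closure_empty, Subgroup.mem_bot] at h

end RightAngledPolytope

/-! ### Compact sets and neighbourhoods described by the form -/

namespace Hyp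

variable {n : ℕ}

/-- `-⟨w, v⟩ ≥ w₀ (v₀ - |v|)`, and `2 v₀ (v₀ - |v|) ≥ v₀² - |v|² = 1`. -/
theorem time_le (w v : Hyp n) : w.1.1 ≤ 2 * v.1.1 * -lorentz w.1 v.1 := by
  have h1 := v.2.1
  rw [lorentz, real_inner_self_eq_norm_sq] at h1
  have h2 := w.isFuture.norm_lt
  have h3 := v.isFuture.norm_lt
  have h4 := real_inner_le_norm w.1.2 v.1.2
  have h5 : 1 ≤ 2 * v.1.1 * (v.1.1 - ‖v.1.2‖) := by nlinarith
  have h6 : w.1.1 * (v.1.1 - ‖v.1.2‖) ≤ -lorentz w.1 v.1 := by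
    unfold lorentz
    nlinarith [mul_le_mul_of_nonneg_right h2.le (norm_nonneg v.1.2)]
  calc w.1.1 = w.1.1 * 1 := (mul_one _).symm
    _ ≤ w.1.1 * (2 * v.1.1 * (v.1.1 - ‖v.1.2‖)) := mul_le_mul_of_nonneg_left h5 w.2.2.le
    _ = 2 * v.1.1 * (w.1.1 * (v.1.1 - ‖v.1.2‖)) := by ring
    _ ≤ _ := mul_le_mul_of_nonneg_left h6 (by linarith [v.2.2])

theorem isCompact_time_le (R : ℝ) : IsCompact {w : Hyp n | w.1.1 ≤ R} := by
  have h := (globalChart n).isClosedEmbedding.isCompact_preimage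
    (isCompact_closedBall (0 : EuclideanSpace ℝ (Fin n)) R)
  refine h.of_isClosed_subset (isClosed_le (by fun_prop) continuous_const) fun w hw => ?_
  rw [Set.mem_preimage, mem_closedBall_zero_iff]
  exact w.isFuture.norm_lt.le.trans hw

theorem isCompact_neg_lorentz_le (x : Hyp n) (R : ℝ) :
    IsCompact {z : Hyp n | -lorentz x.1 z.1 ≤ R} := by
  refine (isCompact_time_le (2 * x.1.1 * R)).of_isClosed_subset
    (isClosed_le (by fun_prop) continuous_const) fun z hz => ?_
  have h := time_le z x
  rw [lorentz_comm] at h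
  exact h.trans (mul_le_mul_of_nonneg_left hz (by linarith [x.2.2]))

/-- The sets `{z | -⟨x, z⟩ < 1 + δ}` form a neighbourhood basis of `x`. -/
theorem exists_neg_lorentz_lt_subset (x : Hyp n) {U : Set (Hyp n)} (hU : U ∈ 𝓝 x) :
    ∃ c > 1, ∀ z : Hyp n, -lorentz x.1 z.1 < c → z ∈ U := by
  obtain ⟨V, hVU, hV, hxV⟩ := mem_nhds_iff.1 hU
  -- Outside `V` the continuous function `-⟨x, ·⟩` exceeds `1`, hence by compactness is bounded away
  -- from `1`; the cutoff `2` only serves compactness.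
  have hK : IsCompact ({z : Hyp n | -lorentz x.1 z.1 ≤ 2} \ V) :=
    (isCompact_neg_lorentz_le x 2).diff hV
  obtain ⟨c, hc, hcK⟩ := hK.exists_forall_le' (f := fun z : Hyp n => -lorentz x.1 z.1) (a := 1)
    (by fun_prop) (fun z hz => by
      have : x ≠ z := by rintro rfl; exact hz.2 hxV
      linarith [lorentz_lt_neg_one this])
  refine ⟨min c 2, lt_min hc one_lt_two, fun z hz => hVU ?_⟩
  by_contra hzV
  have := hcK z ⟨(hz.trans_le (min_le_right _ _)).le, hzV⟩
  exact absurd (hz.trans_le (min_le_left _ _)) (not_lt.2 this)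

end Hyp

/-! ### Proper discontinuity, and covering by translates -/

namespace RightAngledPolytope

variable {n : ℕ} {ι : Type*} (P : RightAngledPolytope n ι)

/-- If `v • x` and `w • x` are close, then `v⁻¹ * w` moves `x` within a neighbourhood contained in
the polytope, so `v = w`. Each point thus has a neighbourhood containing at most one translate. -/
theorem finite_smul_mem (hn : 2 ≤ n) {x : Hyp n} (hx : ∀ i, lorentz x.toMink (P.normal i) < 0)
    {C : Set (Hyp n)} (hC : IsCompact C) : {w : P.CoxeterGroup | w • x ∈ C}.Finite := by
  have := P.finite
  have hU : P.carrier ∈ 𝓝 x := by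
    have : ∀ᶠ z : Hyp n in 𝓝 x, ∀ i, lorentz z.1 (P.normal i) < 0 := by
      rw [eventually_all]
      intro i
      have : IsOpen {z : Hyp n | lorentz z.1 (P.normal i) < 0} :=
        isOpen_lt (by fun_prop) continuous_const
      exact this.mem_nhds (hx i)
    filter_upwards [this] with z hz i using (hz i).le
  obtain ⟨c, hc, hcU⟩ := x.exists_neg_lorentz_lt_subset hU
  refine hC.induction_on (p := fun s => {w : P.CoxeterGroup | w • x ∈ s}.Finite) ?_ ?_ ?_ ?_
  · simp
  · exact fun s t hst ht => ht.subset fun w hw => hst hw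
  · intro s t hs ht
    exact (hs.union ht).subset fun w hw => hw
  · intro z _
    have h1 : ∀ᶠ p : Hyp n × Hyp n in 𝓝 (z, z), -lorentz p.1.1 p.2.1 < c := by
      have h2 : IsOpen {p : Hyp n × Hyp n | -lorentz p.1.1 p.2.1 < c} :=
        isOpen_lt (by fun_prop) continuous_const
      refine h2.mem_nhds ?_
      change -lorentz z.1 z.1 < c
      rw [z.2.1]; linarith
    rw [nhds_prod_eq, eventually_prod_self_iff'] at h1
    obtain ⟨W, hW, hWc⟩ := h1
    refine ⟨W, mem_nhdsWithin_of_mem_nhds hW, Set.Subsingleton.finite fun v hv w hw => ?_⟩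
    have h2 := hWc _ hv _ hw
    have h3 : lorentz (v • x : Hyp n).1 (w • x : Hyp n).1 = lorentz x.1 ((v⁻¹ * w) • x : Hyp n).1 := by
      rw [← P.lorentz_smul_smul v x, smul_smul, mul_inv_cancel_left]
    rw [h3] at h2
    exact inv_mul_eq_one.1 (P.eq_one_of_smul_mem hn hx (hcU _ h2))

/-- If `u ∈ K` and `w • u ∈ L`, then `w • x` is at bounded distance from `L`, so it stays in a fixed
compact set. -/
theorem properlyDiscontinuousSMul (hn : 2 ≤ n) :
    ProperlyDiscontinuousSMul P.CoxeterGroup (Hyp n) where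
  finite_disjoint_inter_image {K L} hK hL := by
    obtain ⟨x, hx⟩ := P.exists_interior
    obtain ⟨A, hA⟩ := hK.bddAbove_image (f := fun z : Hyp n => -lorentz x.1 z.1) (by fun_prop)
    obtain ⟨B, hB⟩ := hL.bddAbove_image (f := fun z : Hyp n => z.1.1) (by fun_prop)
    refine (P.finite_smul_mem hn hx (Hyp.isCompact_time_le (2 * B * A))).subset ?_
    rintro w ⟨_, ⟨u, hu, rfl⟩, hv⟩
    have h1 := Hyp.time_le (w • x) (w • u)
    rw [lorentz_smul_smul] at h1
    have h2 : -lorentz x.1 u.1 ≤ A := hA ⟨u, hu, rfl⟩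
    have h3 : (w • u : Hyp n).1.1 ≤ B := hB ⟨_, hv, rfl⟩
    have h4 := (w • u : Hyp n).2.2
    have h5 : 0 < -lorentz x.1 u.1 := neg_pos.2 (x.isFuture.lorentz_neg u.isFuture)
    refine h1.trans (mul_le_mul (by linarith) h2 h5.le (by linarith))

/-- The translates of the polytope cover hyperbolic space. -/
theorem exists_smul_mem_carrier (hn : 2 ≤ n) (y : Hyp n) :
    ∃ w : P.CoxeterGroup, w • y ∈ P.carrier := by
  have := P.properlyDiscontinuousSMul hn
  obtain ⟨x, hx⟩ := P.exists_interior
  let f : P.CoxeterGroup → ℝ := fun w => -lorentz x.1 (w • y : Hyp n).1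
  -- Only finitely many translates of `y` are as close to `x` as `y`, so a closest one exists. If it
  -- violated the inequality of a facet, reflecting in that facet would bring it closer.
  have hfin : {w | f w ≤ f 1}.Finite := by
    have h := ProperlyDiscontinuousSMul.finite_disjoint_inter_image (Γ := P.CoxeterGroup)
      (isCompact_singleton (x := y)) (x.isCompact_neg_lorentz_le (f 1))
    exact h.subset fun w hw => ⟨w • y, ⟨y, rfl, rfl⟩, hw⟩
  obtain ⟨w, hw1, hw⟩ := Set.exists_min_image _ f hfin ⟨1, le_refl (f 1)⟩
  refine ⟨w, fun i => ?_⟩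
  have h1 : f w ≤ f (P.gen i * w) := by
    by_cases h : f (P.gen i * w) ≤ f 1
    · exact hw _ h
    · exact le_trans hw1 (not_le.1 h).le
  simp only [f] at h1
  rw [mul_smul, gen_smul, lorentzReflect, lorentz_sub_smul_right] at h1
  have h2 : lorentz x.1 (P.normal i) < 0 := hx i
  change lorentz (w • y : Hyp n).1 (P.normal i) ≤ 0
  nlinarith

end RightAngledPolytope

/-! ### Freeness of the action of the kernel -/

namespace Colouring

variable {n : ℕ} {ι : Type*} {P : RightAngledPolytope n ι} {V : Type*}
  [AddCommGroup V] [Module (ZMod 2) V] (c : Colouring P V)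

theorem hom_gen (i : ι) : c.hom (P.gen i) = Multiplicative.ofAdd (c.colour i) := by
  rw [hom, RightAngledPolytope.liftHom_gen]

theorem hom_mem_span {S : Set ι} {w : P.CoxeterGroup} (hw : w ∈ Subgroup.closure (P.gen '' S)) :
    (c.hom w).toAdd ∈ Submodule.span (ZMod 2) (c.colour '' S) := by
  induction hw using Subgroup.closure_induction with
  | mem x hx =>
    obtain ⟨i, hi, rfl⟩ := hx
    rw [hom_gen]
    exact Submodule.subset_span ⟨i, hi, rfl⟩
  | one => rw [map_one]; exact Submodule.zero_mem _
  | mul x y _ _ hx hy => rw [map_mul]; exact Submodule.add_mem _ hx hy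
  | inv x _ hx => rw [map_inv]; exact Submodule.neg_mem _ hx

/-- Reflections in facets through `v` commute, so an element uses a new generator `i` at most once,
as a left factor. If it does, triviality of its colour expresses `colour i` through the other
colours at `v`, against independence. -/
theorem eq_one_of_mem_closure {v : Hyp n} (hn : 2 ≤ n) (hv : P.IsVertex v) (S : Finset ι)
    (hS : ∀ i ∈ S, v ∈ P.facet i) {w : P.CoxeterGroup}
    (hw : w ∈ Subgroup.closure (P.gen '' S)) (h : c.hom w = 1) : w = 1 := by
  classical
  induction S using Finset.induction_on generalizing w with
  | empty => simpa using hw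
  | insert i S hi ih =>
    have ih' := fun {w} => ih (w := w) fun j hj => hS j (Finset.mem_insert_of_mem hj)
    have hvi := hS i (Finset.mem_insert_self i S)
    have h1 : w ∈ Subgroup.closure (P.gen '' S) ∨
        ∃ w' ∈ Subgroup.closure (P.gen '' S), w = P.gen i * w' := by
      clear h
      have hstep : ∀ j ∈ insert i S, ∀ y, (y ∈ Subgroup.closure (P.gen '' S) ∨
          ∃ w' ∈ Subgroup.closure (P.gen '' S), y = P.gen i * w') →
          (P.gen j * y ∈ Subgroup.closure (P.gen '' S) ∨
          ∃ w' ∈ Subgroup.closure (P.gen '' S), P.gen j * y = P.gen i * w') := by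
        intro j hj y hy
        rcases Finset.mem_insert.1 hj with rfl | hjS
        · rcases hy with hy | ⟨w', hw', rfl⟩
          · exact Or.inr ⟨y, hy, rfl⟩
          · exact Or.inl (by rwa [← mul_assoc, P.gen_mul_gen_self, one_mul])
        · have hjm : P.gen j ∈ Subgroup.closure (P.gen '' S) :=
            Subgroup.subset_closure ⟨j, hjS, rfl⟩
          rcases hy with hy | ⟨w', hw', rfl⟩
          · exact Or.inl (mul_mem hjm hy)
          · have hji : j ≠ i := fun h => hi (h ▸ hjS)
            have hcomm := P.gen_commute (P.adjacent_of_mem hn hji (hS j hj) hvi)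
            refine Or.inr ⟨P.gen j * w', mul_mem hjm hw', ?_⟩
            rw [← mul_assoc, hcomm.eq, mul_assoc]
      induction hw using Subgroup.closure_induction_left with
      | one => exact Or.inl (one_mem _)
      | mul_left x hx y hy hyp =>
        obtain ⟨j, hj, rfl⟩ := hx
        exact hstep j (Finset.mem_coe.1 hj) y hyp
      | inv_mul_cancel x hx y hy hyp =>
        obtain ⟨j, hj, rfl⟩ := hx
        rw [P.inv_gen]
        exact hstep j (Finset.mem_coe.1 hj) y hyp
    rcases h1 with h1 | ⟨w', hw', rfl⟩
    · exact ih' h1 h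
    · exfalso
      have hspan := c.hom_mem_span hw'
      rw [map_mul, hom_gen] at h
      have h2 : c.colour i + (c.hom w').toAdd = 0 := h
      rw [← neg_mem_iff, ← eq_neg_of_add_eq_zero_left h2] at hspan
      have hli := c.linearIndependent v hv
      refine hli.notMem_span_image (s := {F | F.1 ∈ S}) (x := ⟨i, hvi⟩) hi ?_
      refine Submodule.span_mono ?_ hspan
      rintro _ ⟨j, hj, rfl⟩
      exact ⟨⟨j, hS j (Finset.mem_insert_of_mem hj)⟩, hj, rfl⟩

/-- The kernel of a colouring acts freely. -/
theorem eq_one_of_smul_eq (hn : 2 ≤ n) {w : P.CoxeterGroup} (hw : c.hom w = 1) {x : Hyp n}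
    (hx : w • x = x) : w = 1 := by
  have := P.finite
  obtain ⟨u, hu⟩ := P.exists_smul_mem_carrier hn x
  -- Conjugation moves the fixed point into the polytope without leaving the kernel. A vertex lying
  -- on every facet through that point then supplies the independent colours.
  have h1 : (u * w * u⁻¹) • u • x = u • x := by
    rw [smul_smul, inv_mul_cancel_right, mul_smul, hx]
  have h2 := (P.eq_and_mem_closure_of_smul_mem hn hu (u * w * u⁻¹) (by rwa [h1])).2
  obtain ⟨v, hv, hvi⟩ := P.exists_isVertex hu
  have h3 := c.eq_one_of_mem_closure hn hv (Set.toFinite {i | u • x ∈ P.facet i}).toFinset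
    (by simpa using hvi) (by simpa using h2) (by rw [map_mul, map_mul, hw]; simp)
  rwa [conj_eq_one_iff] at h3

end Colouring

/-! ### Smooth structure and orientability of quotients of `ℝⁿ` -/

theorem ContinuousLinearMap.det_comp {E : Type*} [NormedAddCommGroup E] [NormedSpace ℝ E]
    (A B : E →L[ℝ] E) : (A.comp B).det = A.det * B.det :=
  LinearMap.det_comp (A : E →ₗ[ℝ] E) (B : E →ₗ[ℝ] E)

/-- A quotient of `ℝⁿ` by a family of smooth maps. -/
structure IsDeckQuotient {n : ℕ} {M : Type*} [TopologicalSpace M]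
    (q : EuclideanSpace ℝ (Fin n) → M)
    (D : Set (EuclideanSpace ℝ (Fin n) → EuclideanSpace ℝ (Fin n))) : Prop where
  isLocalHomeomorph : IsLocalHomeomorph q
  surjective : Function.Surjective q
  contDiff : ∀ T ∈ D, ContDiff ℝ ∞ T
  map_eq : ∀ T ∈ D, ∀ v, q (T v) = q v
  exists_eq : ∀ v w, q v = q w → ∃ T ∈ D, T v = w

namespace IsDeckQuotient

variable {n : ℕ} {M : Type*} [TopologicalSpace M] {q : EuclideanSpace ℝ (Fin n) → M}
  {D : Set (EuclideanSpace ℝ (Fin n) → EuclideanSpace ℝ (Fin n))}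

theorem exists_chart (h : IsDeckQuotient q D) (m : M) :
    ∃ e : OpenPartialHomeomorph (EuclideanSpace ℝ (Fin n)) M, ⇑e = q ∧ m ∈ e.target := by
  obtain ⟨v, rfl⟩ := h.surjective m
  obtain ⟨e, hv, he⟩ := h.isLocalHomeomorph v
  exact ⟨e, he.symm, by rw [he]; exact e.map_source hv⟩

/-- The charted space whose charts are the local inverses of the quotient map. -/
@[reducible]
def chartedSpace (h : IsDeckQuotient q D) : ChartedSpace (EuclideanSpace ℝ (Fin n)) M where
  atlas := {φ | ∃ e : OpenPartialHomeomorph (EuclideanSpace ℝ (Fin n)) M, ⇑e = q ∧ φ = e.symm}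
  chartAt m := (h.exists_chart m).choose.symm
  mem_chart_source m := (h.exists_chart m).choose_spec.2
  chart_mem_atlas m := ⟨_, (h.exists_chart m).choose_spec.1, rfl⟩

/-- A deck map `T` agreeing with the transition at `v` stays in the source of `e'` nearby, where `q`
is injective, so the two agree there. -/
theorem transition_eventuallyEq (h : IsDeckQuotient q D)
    {e e' : OpenPartialHomeomorph (EuclideanSpace ℝ (Fin n)) M} (he : ⇑e = q) (he' : ⇑e' = q)
    {v : EuclideanSpace ℝ (Fin n)} (hv : v ∈ (e.trans e'.symm).source) :
    ∃ T ∈ D, ⇑(e.trans e'.symm) =ᶠ[𝓝 v] T := by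
  have hv2 : q v ∈ e'.target := by
    rw [OpenPartialHomeomorph.trans_source] at hv
    rw [← he]; exact hv.2
  have h1 : q v = q (e'.symm (q v)) := by
    have h2 := e'.right_inv hv2
    rw [he'] at h2
    exact h2.symm
  obtain ⟨T, hT, hTv⟩ := h.exists_eq _ _ h1
  refine ⟨T, hT, ?_⟩
  have h2 : T ⁻¹' e'.source ∈ 𝓝 v := by
    refine (h.contDiff T hT).continuous.continuousAt.preimage_mem_nhds ?_
    rw [hTv]
    exact e'.open_source.mem_nhds (e'.map_target hv2)
  filter_upwards [h2] with y hy
  change e'.symm (e y) = T y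
  rw [he, ← h.map_eq T hT, ← he', e'.left_inv hy]

theorem isManifold (h : IsDeckQuotient q D) :
    letI := h.chartedSpace
    IsManifold 𝓘(ℝ, EuclideanSpace ℝ (Fin n)) ∞ M := by
  let := h.chartedSpace
  refine isManifold_of_contDiffOn _ _ _ ?_
  rintro _ _ ⟨e, he, rfl⟩ ⟨e', he', rfl⟩ v hv
  obtain ⟨T, hT, hTv⟩ := h.transition_eventuallyEq he he' (v := v) (by simpa using hv)
  have h1 : ContDiffAt ℝ ∞ (e.trans e'.symm) v :=
    (h.contDiff T hT).contDiffAt.congr_of_eventuallyEq hTv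
  exact h1.contDiffWithinAt

theorem symm_mem_maximalAtlas (h : IsDeckQuotient q D)
    {e : OpenPartialHomeomorph (EuclideanSpace ℝ (Fin n)) M} (he : ⇑e = q) :
    letI := h.chartedSpace
    e.symm ∈ IsManifold.maximalAtlas 𝓘(ℝ, EuclideanSpace ℝ (Fin n)) ∞ M := by
  let := h.chartedSpace
  have := h.isManifold
  exact IsManifold.subset_maximalAtlas ⟨e, he, rfl⟩

theorem isLocalDiffeomorph (h : IsDeckQuotient q D) {X : Type*} [TopologicalSpace X]
    [ChartedSpace (EuclideanSpace ℝ (Fin n)) X]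
    [IsManifold 𝓘(ℝ, EuclideanSpace ℝ (Fin n)) ∞ X] (g : X ≃ₜ EuclideanSpace ℝ (Fin n))
    (hg : g.toOpenPartialHomeomorph ∈
      IsManifold.maximalAtlas 𝓘(ℝ, EuclideanSpace ℝ (Fin n)) ∞ X) :
    letI := h.chartedSpace
    IsLocalDiffeomorph 𝓘(ℝ, EuclideanSpace ℝ (Fin n)) 𝓘(ℝ, EuclideanSpace ℝ (Fin n)) ∞
      (q ∘ g) := by
  let := h.chartedSpace
  have := h.isManifold
  intro x
  obtain ⟨e, hx, he⟩ := h.isLocalHomeomorph (g x)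
  have hm := h.symm_mem_maximalAtlas he.symm
  let f := g.toOpenPartialHomeomorph.trans e
  refine ⟨{ f with
    contMDiffOn_toFun := ?_
    contMDiffOn_invFun := ?_ }, ⟨Set.mem_univ _, hx⟩, ?_⟩
  · exact (contMDiffOn_symm_of_mem_maximalAtlas hm).comp
      ((contMDiffOn_of_mem_maximalAtlas hg).mono (fun _ _ => Set.mem_univ _)) (fun y hy => hy.2)
  · exact (contMDiffOn_symm_of_mem_maximalAtlas hg).comp
      ((contMDiffOn_of_mem_maximalAtlas hm).mono (fun y hy => hy.1)) (fun _ _ => Set.mem_univ _)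
  · intro y _
    change q (g y) = e (g y)
    rw [he]

theorem isOrientable (h : IsDeckQuotient q D)
    (hdet : ∀ T ∈ D, ∀ v, 0 < (fderiv ℝ T v).det) :
    letI := h.chartedSpace
    IsOrientable n M := by
  let := h.chartedSpace
  have := h.isManifold
  refine ⟨atlas (EuclideanSpace ℝ (Fin n)) M, IsManifold.subset_maximalAtlas,
    fun m => ⟨_, chart_mem_atlas _ m, mem_chart_source _ m⟩, ?_⟩
  rintro _ ⟨e, he, rfl⟩ _ ⟨e', he', rfl⟩ v hv
  obtain ⟨T, hT, hTv⟩ := h.transition_eventuallyEq he he' (v := v) hv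
  have h1 : fderiv ℝ (e.symm.symm.trans e'.symm) v = fderiv ℝ T v := hTv.fderiv_eq
  rw [h1]
  exact hdet T hT v

section Jacobian

variable {φ φ' : OpenPartialHomeomorph M (EuclideanSpace ℝ (Fin n))} {v : EuclideanSpace ℝ (Fin n)}

theorem contDiffOn_transition [ChartedSpace (EuclideanSpace ℝ (Fin n)) M]
    [IsManifold 𝓘(ℝ, EuclideanSpace ℝ (Fin n)) ∞ M]
    (hφ : φ ∈ IsManifold.maximalAtlas 𝓘(ℝ, EuclideanSpace ℝ (Fin n)) ∞ M)
    (hφ' : φ' ∈ IsManifold.maximalAtlas 𝓘(ℝ, EuclideanSpace ℝ (Fin n)) ∞ M) :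
    ContDiffOn ℝ ∞ (φ.symm.trans φ') (φ.symm.trans φ').source := by
  rw [← contMDiffOn_iff_contDiffOn]
  exact contMDiffOn_of_mem_contDiffGroupoid
    (IsManifold.compatible_of_mem_maximalAtlas hφ hφ')

/-- Arbitrary charts of the quotient are compared upstairs, as functions `φ ∘ q` on the connected
space `ℝⁿ`. -/
theorem contDiffAt_comp (h : IsDeckQuotient q D)
    (hφ : letI := h.chartedSpace
      φ ∈ IsManifold.maximalAtlas 𝓘(ℝ, EuclideanSpace ℝ (Fin n)) ∞ M) (hv : q v ∈ φ.source) :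
    ContDiffAt ℝ ∞ (φ ∘ q) v := by
  let := h.chartedSpace
  have := h.isManifold
  obtain ⟨e, hx, he⟩ := h.isLocalHomeomorph v
  have h1 := contDiffOn_transition (h.symm_mem_maximalAtlas he.symm) hφ
  have h2 : v ∈ (e.symm.symm.trans φ).source := ⟨hx, by rw [he] at hv; exact hv⟩
  have h3 := h1.contDiffAt ((OpenPartialHomeomorph.open_source _).mem_nhds h2)
  rw [he]
  exact h3

theorem det_fderiv_comp_ne_zero (h : IsDeckQuotient q D)
    (hφ : letI := h.chartedSpace
      φ ∈ IsManifold.maximalAtlas 𝓘(ℝ, EuclideanSpace ℝ (Fin n)) ∞ M) (hv : q v ∈ φ.source) :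
    (fderiv ℝ (φ ∘ q) v).det ≠ 0 := by
  let := h.chartedSpace
  have := h.isManifold
  obtain ⟨e, hx, he⟩ := h.isLocalHomeomorph v
  have hv' : e v ∈ φ.source := by rw [he] at hv; exact hv
  have h1 := contDiffOn_transition hφ (h.symm_mem_maximalAtlas he.symm)
  have h2 : φ (q v) ∈ (φ.symm.trans e.symm).source := by
    refine ⟨φ.map_source hv, ?_⟩
    change φ.symm (φ (q v)) ∈ e.target
    rw [φ.left_inv hv, he]
    exact e.map_source hx
  have h3 := h1.contDiffAt ((OpenPartialHomeomorph.open_source _).mem_nhds h2)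
  have h4 : (φ.symm.trans e.symm) ∘ (φ ∘ q) =ᶠ[𝓝 v] id := by
    have h5 : (e.trans φ).source ∈ 𝓝 v :=
      (OpenPartialHomeomorph.open_source _).mem_nhds ⟨hx, hv'⟩
    filter_upwards [h5] with y hy
    change e.symm (φ.symm (φ (q y))) = y
    rw [he]
    exact (congrArg e.symm (φ.left_inv hy.2)).trans (e.left_inv hy.1)
  have h6 := h4.fderiv_eq (𝕜 := ℝ)
  rw [fderiv_comp v (h3.differentiableAt (by simp))
    ((h.contDiffAt_comp hφ hv).differentiableAt (by simp)), fderiv_id] at h6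
  have h7 : (fderiv ℝ (φ.symm.trans e.symm) (φ (q v))).det * (fderiv ℝ (φ ∘ q) v).det = 1 :=
    (ContinuousLinearMap.det_comp _ _).symm.trans ((congrArg ContinuousLinearMap.det h6).trans
      LinearMap.det_id)
  intro h0
  rw [h0, mul_zero] at h7
  exact zero_ne_one h7

theorem det_fderiv_comp_eq (h : IsDeckQuotient q D)
    (hφ : letI := h.chartedSpace
      φ ∈ IsManifold.maximalAtlas 𝓘(ℝ, EuclideanSpace ℝ (Fin n)) ∞ M)
    (hφ' : letI := h.chartedSpace
      φ' ∈ IsManifold.maximalAtlas 𝓘(ℝ, EuclideanSpace ℝ (Fin n)) ∞ M)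
    (hv : q v ∈ φ.source) (hv' : q v ∈ φ'.source) :
    (fderiv ℝ (φ' ∘ q) v).det =
      (fderiv ℝ (φ.symm.trans φ') (φ (q v))).det * (fderiv ℝ (φ ∘ q) v).det := by
  let := h.chartedSpace
  have := h.isManifold
  have h2 : φ (q v) ∈ (φ.symm.trans φ').source := by
    refine ⟨φ.map_source hv, ?_⟩
    change φ.symm (φ (q v)) ∈ φ'.source
    rwa [φ.left_inv hv]
  have h3 := (contDiffOn_transition hφ hφ').contDiffAt
    ((OpenPartialHomeomorph.open_source _).mem_nhds h2)
  have h4 : φ' ∘ q =ᶠ[𝓝 v] (φ.symm.trans φ') ∘ (φ ∘ q) := by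
    filter_upwards [h.isLocalHomeomorph.continuous.continuousAt.preimage_mem_nhds
      (φ.open_source.mem_nhds hv)] with y hy
    change φ' (q y) = φ' (φ.symm (φ (q y)))
    rw [φ.left_inv hy]
  rw [h4.fderiv_eq, fderiv_comp v (h3.differentiableAt (by simp))
    ((h.contDiffAt_comp hφ hv).differentiableAt (by simp))]
  exact ContinuousLinearMap.det_comp _ _

theorem det_fderiv_comp_deck (h : IsDeckQuotient q D)
    (hφ : letI := h.chartedSpace
      φ ∈ IsManifold.maximalAtlas 𝓘(ℝ, EuclideanSpace ℝ (Fin n)) ∞ M) (hv : q v ∈ φ.source)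
    {T : EuclideanSpace ℝ (Fin n) → EuclideanSpace ℝ (Fin n)} (hT : T ∈ D) :
    (fderiv ℝ (φ ∘ q) v).det = (fderiv ℝ (φ ∘ q) (T v)).det * (fderiv ℝ T v).det := by
  have h1 : φ ∘ q = (φ ∘ q) ∘ T := by
    funext y
    simp [h.map_eq T hT]
  conv_lhs => rw [h1]
  rw [fderiv_comp v ((h.contDiffAt_comp hφ (by rwa [h.map_eq T hT])).differentiableAt (by simp))
    ((h.contDiff T hT).differentiable (by simp) v)]
  exact ContinuousLinearMap.det_comp _ _

theorem eventually_det_fderiv_comp (h : IsDeckQuotient q D)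
    (hφ : letI := h.chartedSpace
      φ ∈ IsManifold.maximalAtlas 𝓘(ℝ, EuclideanSpace ℝ (Fin n)) ∞ M) (hv : q v ∈ φ.source)
    {U : Set ℝ} (hU : IsOpen U) (hvU : (fderiv ℝ (φ ∘ q) v).det ∈ U) :
    ∀ᶠ y in 𝓝 v, q y ∈ φ.source ∧ (fderiv ℝ (φ ∘ q) y).det ∈ U := by
  have h1 : ContinuousAt (fderiv ℝ (φ ∘ q)) v :=
    ((h.contDiffAt_comp hφ hv).fderiv_right (m := 0) (by simp)).continuousAt
  have h2 : ContinuousAt (fun y => (fderiv ℝ (φ ∘ q) y).det) v :=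
    ContinuousLinearMap.continuous_det.continuousAt.comp h1
  exact inter_mem (h.isLocalHomeomorph.continuous.continuousAt.preimage_mem_nhds
    (φ.open_source.mem_nhds hv)) (h2.preimage_mem_nhds (hU.mem_nhds hvU))

end Jacobian

/-- An orienting family would cover `ℝⁿ` by two open sets, where some `φ ∘ q` has positive,
respectively negative, Jacobian. Both are nonempty, since `T` reverses the sign; by connectedness
they meet, and there a transition has negative Jacobian. -/
theorem not_isOrientable (h : IsDeckQuotient q D)
    {T : EuclideanSpace ℝ (Fin n) → EuclideanSpace ℝ (Fin n)} (hT : T ∈ D)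
    (hdet : ∀ v, (fderiv ℝ T v).det < 0) :
    letI := h.chartedSpace
    ¬ IsOrientable n M := by
  let := h.chartedSpace
  rintro ⟨A, hA, hcov, hpos⟩
  let S : Set ℝ → Set (EuclideanSpace ℝ (Fin n)) := fun U =>
    {v | ∃ φ ∈ A, q v ∈ φ.source ∧ (fderiv ℝ (φ ∘ q) v).det ∈ U}
  have hopen : ∀ U, IsOpen U → IsOpen (S U) := by
    intro U hU
    rw [isOpen_iff_mem_nhds]
    rintro v ⟨φ, hφ, hv, hvU⟩
    filter_upwards [h.eventually_det_fderiv_comp (hA hφ) hv hU hvU] with y hy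
    exact ⟨φ, hφ, hy⟩
  have hcover : ∀ v, v ∈ S (Set.Ioi 0) ∨ v ∈ S (Set.Iio 0) := by
    intro v
    obtain ⟨φ, hφ, hv⟩ := hcov (q v)
    rcases (h.det_fderiv_comp_ne_zero (hA hφ) hv).lt_or_gt with h1 | h1
    · exact Or.inr ⟨φ, hφ, hv, h1⟩
    · exact Or.inl ⟨φ, hφ, hv, h1⟩
  have hne : (S (Set.Ioi 0)).Nonempty ∧ (S (Set.Iio 0)).Nonempty := by
    obtain ⟨φ, hφ, hv⟩ := hcov (q 0)
    have hTv : q (T 0) ∈ φ.source := by rwa [h.map_eq T hT]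
    have h1 := h.det_fderiv_comp_deck (hA hφ) hv hT
    have h2 := hdet 0
    rcases (h.det_fderiv_comp_ne_zero (hA hφ) hv).lt_or_gt with h3 | h3
    · refine ⟨⟨T 0, φ, hφ, hTv, ?_⟩, ⟨0, φ, hφ, hv, h3⟩⟩
      rw [h1] at h3
      exact pos_of_mul_neg_left h3 h2.le
    · refine ⟨⟨0, φ, hφ, hv, h3⟩, ⟨T 0, φ, hφ, hTv, ?_⟩⟩
      rw [h1] at h3
      exact neg_of_mul_pos_left h3 h2.le
  obtain ⟨v, -, ⟨φ, hφ, hv, h1⟩, ⟨φ', hφ', hv', h2⟩⟩ := isPreconnected_univ (S (Set.Ioi 0))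
    (S (Set.Iio 0)) (hopen _ isOpen_Ioi) (hopen _ isOpen_Iio) (fun v _ => hcover v)
    (by simpa using hne.1) (by simpa using hne.2)
  rw [Set.mem_Iio, h.det_fderiv_comp_eq (hA hφ) (hA hφ') hv hv'] at h2
  have h3 := hpos φ hφ φ' hφ' (φ (q v)) ⟨φ.map_source hv, by
    change φ.symm (φ (q v)) ∈ φ'.source
    rwa [φ.left_inv hv]⟩
  exact absurd h2 (not_lt.2 (mul_pos h3 h1).le)

end IsDeckQuotient

/-! ### Jacobians of the action in the global chart -/

namespace RightAngledPolytope

variable {n : ℕ} {ι : Type*} (P : RightAngledPolytope n ι)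

/-- The action of the Coxeter group on hyperbolic space in the global chart. -/
def chartAction (w : P.CoxeterGroup) (v : EuclideanSpace ℝ (Fin n)) : EuclideanSpace ℝ (Fin n) :=
  Hyp.globalChart n (w • (Hyp.globalChart n).symm v)

theorem chartAction_mul (v w : P.CoxeterGroup) :
    P.chartAction (v * w) = P.chartAction v ∘ P.chartAction w := by
  funext x
  simp only [chartAction, Function.comp_apply, Homeomorph.symm_apply_apply, mul_smul]

theorem chartAction_one : P.chartAction 1 = id := by
  funext x
  simp [chartAction]

theorem chartAction_eq (w : P.CoxeterGroup) (v : EuclideanSpace ℝ (Fin n)) :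
    P.chartAction w v = (P.linAction w (√(1 + ‖v‖ ^ 2), v)).2 :=
  congrArg Prod.snd (P.coe_smul w ((Hyp.globalChart n).symm v))

theorem contDiff_chartAction (w : P.CoxeterGroup) : ContDiff ℝ ∞ (P.chartAction w) := by
  have h1 : ContDiff ℝ ∞ fun v : EuclideanSpace ℝ (Fin n) => √(1 + ‖v‖ ^ 2) :=
    (contDiff_const.add (contDiff_norm_sq ℝ)).sqrt fun v => by positivity
  have h2 : ContDiff ℝ ∞ (P.linAction w).toLinearMap.toContinuousLinearMap :=
    ContinuousLinearMap.contDiff _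
  have h3 := contDiff_snd.comp (h2.comp (h1.prodMk contDiff_id))
  convert h3 using 1
  funext v
  exact P.chartAction_eq w v

/-- The sign of an element of the Coxeter group, the parity of its length. -/
def sign : P.CoxeterGroup →* ℤˣ :=
  P.liftHom (fun _ => -1) (fun _ => by simp) (fun _ _ _ => rfl)

theorem sign_gen (i : ι) : P.sign (P.gen i) = -1 := by rw [sign, liftHom_gen]

/-- The derivative is the identity plus a rank-one map, so its determinant is `1 + φ e.2`.
Multiplied by the time coordinate `s` of the point, this is minus the time coordinate of its mirror
image. -/
theorem det_fderiv_chartAction_gen_neg (i : ι) (v : EuclideanSpace ℝ (Fin n)) :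
    (fderiv ℝ (P.chartAction (P.gen i)) v).det < 0 := by
  set e := P.normal i with he
  set s := √(1 + ‖v‖ ^ 2) with hs
  have hs0 : 0 < s := Real.sqrt_pos.2 (by positivity)
  have h1 : HasFDerivAt (fun x : EuclideanSpace ℝ (Fin n) => √(1 + ‖x‖ ^ 2))
      (s⁻¹ • innerSL ℝ v) v := by
    have := ((hasFDerivAt_id v).norm_sq.const_add 1).sqrt (by positivity)
    refine this.congr_fderiv (ContinuousLinearMap.ext fun x => ?_)
    simp only [id, ContinuousLinearMap.comp_id, smul_apply, smul_eq_mul,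
      ← hs, nsmul_eq_mul, innerSL_apply_apply]
    field_simp
    norm_num
  let φ : EuclideanSpace ℝ (Fin n) →L[ℝ] ℝ := -((2 : ℝ) • (innerSL ℝ e.2 - e.1 • s⁻¹ • innerSL ℝ v))
  have h2 : HasFDerivAt (P.chartAction (P.gen i))
      (ContinuousLinearMap.id ℝ _ + φ.smulRight e.2) v := by
    have h3 : P.chartAction (P.gen i) = fun x : EuclideanSpace ℝ (Fin n) =>
        x + (-(2 * (inner ℝ e.2 x - e.1 * √(1 + ‖x‖ ^ 2)))) • e.2 := by
      funext x
      rw [chartAction_eq, linAction_gen, lorentzReflect, lorentz, real_inner_comm, ← he, neg_smul,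
        ← sub_eq_add_neg, mul_comm e.1]
      rfl
    rw [h3]
    have h4 : HasFDerivAt (fun x : EuclideanSpace ℝ (Fin n) => (inner ℝ e.2 x : ℝ))
      (innerSL ℝ e.2) v := (innerSL ℝ e.2).hasFDerivAt
    exact (hasFDerivAt_id v).add
      ((((h4.sub (h1.const_mul e.1)).const_mul 2).neg).smul_const e.2)
  have h5 : (fderiv ℝ (P.chartAction (P.gen i)) v).det = 1 + φ e.2 := by
    rw [h2.fderiv]
    exact LinearMap.transvection.det φ.toLinearMap e.2
  have h6 := (lorentzReflect_mem (P.normal_unit i) ((Hyp.globalChart n).symm v)).2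
  have h7 : (lorentzReflect e ((Hyp.globalChart n).symm v).1).1 =
      s - 2 * (inner ℝ v e.2 - s * e.1) * e.1 := rfl
  rw [← he, h7] at h6
  have h8 := P.normal_unit i
  rw [← he, lorentz] at h8
  have h9 : s * (1 + φ e.2) = -(s - 2 * (inner ℝ v e.2 - s * e.1) * e.1) := by
    simp only [φ, neg_apply, smul_apply,
      sub_apply, innerSL_apply_apply, smul_eq_mul]
    rw [show (inner ℝ e.2 e.2 : ℝ) = 1 + e.1 * e.1 by linarith]
    field_simp
    ring
  rw [h5]
  by_contra h
  have := mul_nonneg hs0.le (not_lt.1 h)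
  linarith

/-- The sign of an element is the sign of its Jacobian determinant. -/
theorem sign_mul_det_pos (w : P.CoxeterGroup) (v : EuclideanSpace ℝ (Fin n)) :
    0 < ((P.sign w : ℤ) : ℝ) * (fderiv ℝ (P.chartAction w) v).det := by
  induction w using P.gen_induction with
  | one =>
    rw [chartAction_one, fderiv_id, map_one]
    have : (ContinuousLinearMap.id ℝ (EuclideanSpace ℝ (Fin n))).det = 1 := LinearMap.det_id
    rw [this]; norm_num
  | mul i w ih =>
    have hd := fun u => ((P.contDiff_chartAction u).differentiable (by simp))
    rw [chartAction_mul, fderiv_comp v (hd _ _) (hd _ _), map_mul, sign_gen]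
    rw [ContinuousLinearMap.det_comp]
    have h1 := P.det_fderiv_chartAction_gen_neg i (P.chartAction w v)
    push_cast
    nlinarith

end RightAngledPolytope

/-! ### Parity and functionals on the colours -/

namespace RightAngledPolytope

variable {n : ℕ} {ι : Type*} (P : RightAngledPolytope n ι)

/-- `sign` matches Jacobians, while `lengthParity` takes values in `ZMod 2` and can therefore be
compared with functionals on `V`. -/
theorem lengthParity_eq_one_iff (w : P.CoxeterGroup) :
    P.system.lengthParity w = 1 ↔ P.sign w = 1 := by
  have h : P.system.lengthParity w = 1 ∧ P.sign w = 1 ∨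
      P.system.lengthParity w = Multiplicative.ofAdd 1 ∧ P.sign w = -1 := by
    induction w using P.gen_induction with
    | one => exact Or.inl ⟨map_one _, map_one _⟩
    | mul i w ih =>
      rw [map_mul, map_mul, P.sign_gen, ← P.system_simple, CoxeterSystem.lengthParity_simple]
      rcases ih with ⟨h1, h2⟩ | ⟨h1, h2⟩ <;> rw [h1, h2]
      · exact Or.inr ⟨rfl, rfl⟩
      · exact Or.inl ⟨rfl, rfl⟩
  rcases h with ⟨h1, h2⟩ | ⟨h1, h2⟩
  · simp [h1, h2]
  · rw [h1, h2]
    exact iff_of_false (by decide) (by decide)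

end RightAngledPolytope

theorem odd_card_filter_eq_one_iff {s : ℕ} (x : Fin s → ZMod 2) :
    Odd (Finset.univ.filter (fun k => x k = 1)).card ↔ ∑ k, x k = 1 := by
  have h : ∑ k, x k = ((Finset.univ.filter (fun k => x k = 1)).card : ZMod 2) := by
    rw [Finset.card_filter, Nat.cast_sum]
    refine Finset.sum_congr rfl fun k _ => ?_
    generalize x k = a
    revert a
    decide
  rw [h, ZMod.natCast_eq_one_iff_odd]

/-- A functional that is `1` on a spanning set is, in suitable coordinates, the sum of the
coordinates. -/
theorem exists_linearEquiv_sum_eq {V : Type*} [AddCommGroup V] [Module (ZMod 2) V]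
    [FiniteDimensional (ZMod 2) V] {S : Set V} (hS : Submodule.span (ZMod 2) S = ⊤)
    (φ : V →ₗ[ZMod 2] ZMod 2) (hφ : ∀ v ∈ S, φ v = 1) :
    ∃ (s : ℕ) (e : V ≃ₗ[ZMod 2] (Fin s → ZMod 2)), ∀ v, ∑ k, e v k = φ v := by
  -- The basis is extracted from `S` itself, so `φ` is `1` on every basis vector.
  obtain ⟨b, hbS, hbspan, hli⟩ := exists_linearIndependent (ZMod 2) S
  let B := Module.Basis.mk hli (by rw [Subtype.range_coe, hbspan, hS])
  have : Finite b := Module.Finite.finite_basis B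
  cases nonempty_fintype b
  let B' := B.reindex (Fintype.equivFin b)
  refine ⟨_, B'.equivFun, fun v => ?_⟩
  conv_rhs => rw [← B'.sum_equivFun v, map_sum]
  refine Finset.sum_congr rfl fun k _ => ?_
  have : B' k ∈ S := by
    rw [Module.Basis.reindex_apply, Module.Basis.mk_apply]
    exact hbS (Subtype.coe_prop _)
  rw [map_smul, hφ _ this, smul_eq_mul, mul_one]

/-! ### The kernel, its quotient and the orientation criterion -/

namespace Colouring

variable {n : ℕ} {ι : Type*} {P : RightAngledPolytope n ι} {V : Type*}
  [AddCommGroup V] [Module (ZMod 2) V] (c : Colouring P V)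

theorem hom_surjective (hc : c.Spans) : Function.Surjective c.hom := by
  suffices h : ∀ v ∈ Submodule.span (ZMod 2) (Set.range c.colour),
      ∃ w, c.hom w = Multiplicative.ofAdd v from fun v => h v.toAdd (hc ▸ Submodule.mem_top)
  intro v hv
  induction hv using Submodule.span_induction with
  | mem x hx =>
    obtain ⟨i, rfl⟩ := hx
    exact ⟨P.gen i, c.hom_gen i⟩
  | zero => exact ⟨1, map_one _⟩
  | add x y _ _ hx hy =>
    obtain ⟨u, hu⟩ := hx
    obtain ⟨w, hw⟩ := hy
    exact ⟨u * w, by rw [map_mul, hu, hw, ofAdd_add]⟩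
  | smul a x _ hx =>
    have ha : ∀ a : ZMod 2, a = 0 ∨ a = 1 := by decide
    rcases ha a with rfl | rfl
    · exact ⟨1, by rw [zero_smul, map_one, ofAdd_zero]⟩
    · rwa [one_smul]

theorem forall_sign_eq_one_iff (hc : c.Spans) :
    (∀ w, c.hom w = 1 → P.sign w = 1) ↔
      ∃ φ : V →ₗ[ZMod 2] ZMod 2, ∀ F, φ (c.colour F) = 1 := by
  simp only [← P.lengthParity_eq_one_iff]
  constructor
  · intro h
    -- The parity is trivial on the kernel of the surjection to `V`, hence descends; an additive map
    -- between `ZMod 2`-modules is linear.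
    let ψ : Multiplicative V →* Multiplicative (ZMod 2) :=
      c.hom.liftOfSurjective (c.hom_surjective hc) ⟨P.system.lengthParity, fun w hw => h w hw⟩
    refine ⟨(AddMonoidHom.toMultiplicative.symm ψ).toZModLinearMap 2, fun F => ?_⟩
    have h1 : ψ (c.hom (P.gen F)) = P.system.lengthParity (P.gen F) :=
      MonoidHom.liftOfRightInverse_comp_apply _ _ _ _ _
    rw [hom_gen, ← P.system_simple, CoxeterSystem.lengthParity_simple] at h1
    exact h1
  · rintro ⟨φ, hφ⟩ w hw
    have h1 : P.system.lengthParity = (AddMonoidHom.toMultiplicative φ.toAddMonoidHom).comp c.hom := by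
      refine P.system.ext_simple fun i => ?_
      rw [CoxeterSystem.lengthParity_simple, MonoidHom.comp_apply, P.system_simple, hom_gen]
      exact congrArg Multiplicative.ofAdd (hφ i).symm
    rw [h1, MonoidHom.comp_apply, hw, map_one]

theorem forall_sign_eq_one_iff_odd [FiniteDimensional (ZMod 2) V] (hc : c.Spans) :
    (∀ w, c.hom w = 1 → P.sign w = 1) ↔
      ∃ (s : ℕ) (e : V ≃ₗ[ZMod 2] (Fin s → ZMod 2)),
        ∀ F : ι, Odd (Finset.univ.filter (fun k : Fin s => e (c.colour F) k = 1)).card := by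
  rw [c.forall_sign_eq_one_iff hc]
  simp only [odd_card_filter_eq_one_iff]
  constructor
  · rintro ⟨φ, hφ⟩
    obtain ⟨s, e, he⟩ := exists_linearEquiv_sum_eq hc φ (by rintro _ ⟨F, rfl⟩; exact hφ F)
    exact ⟨s, e, fun F => (he _).trans (hφ F)⟩
  · rintro ⟨s, e, he⟩
    refine ⟨(∑ k, LinearMap.proj k) ∘ₗ e.toLinearMap, fun F => ?_⟩
    rw [← he F]
    simp

theorem proj_eq_iff {x y : Hyp n} :
    c.proj x = c.proj y ↔ ∃ w, c.hom w = 1 ∧ w • x = y := by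
  rw [eq_comm]
  refine (Quotient.eq (r := MulAction.orbitRel c.hom.ker (Hyp n))).trans ?_
  rw [MulAction.orbitRel_apply]
  constructor
  · rintro ⟨w, hw⟩
    exact ⟨w, w.2, hw⟩
  · rintro ⟨w, hw, h⟩
    exact ⟨⟨w, hw⟩, h⟩

instance _root_.Hyp.locallyCompactSpace : LocallyCompactSpace (Hyp n) :=
  (Hyp.globalChart n).isClosedEmbedding.locallyCompactSpace

instance continuousConstSMul_ker : ContinuousConstSMul c.hom.ker (Hyp n) :=
  ⟨fun w => continuous_const_smul (w : P.CoxeterGroup)⟩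

theorem isCancelSMul_ker (hn : 2 ≤ n) : IsCancelSMul c.hom.ker (Hyp n) where
  right_cancel' u w x h := by
    have h1 : ((u⁻¹ * w : c.hom.ker) : P.CoxeterGroup) • x = x := by
      change (u⁻¹ * w) • x = x
      rw [mul_smul, ← h, inv_smul_smul]
    have h2 := c.eq_one_of_smul_eq hn (u⁻¹ * w).2 h1
    exact inv_mul_eq_one.1 (Subtype.ext h2)

theorem t2Space_cover (hn : 2 ≤ n) : T2Space c.Cover := by
  have := P.properlyDiscontinuousSMul hn
  exact inferInstanceAs (T2Space (Quotient (MulAction.orbitRel c.hom.ker (Hyp n))))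

theorem isLocalHomeomorph_proj (hn : 2 ≤ n) : IsLocalHomeomorph c.proj := by
  have := P.properlyDiscontinuousSMul hn
  have := c.isCancelSMul_ker hn
  exact (isQuotientCoveringMap_quotientMk_of_properlyDiscontinuousSMul
    (E := Hyp n) (G := c.hom.ker)).isCoveringMap.isLocalHomeomorph

theorem isDeckQuotient (hn : 2 ≤ n) : IsDeckQuotient (c.proj ∘ (Hyp.globalChart n).symm)
    (P.chartAction '' {w | c.hom w = 1}) where
  isLocalHomeomorph :=
    (c.isLocalHomeomorph_proj hn).comp (Hyp.globalChart n).symm.isLocalHomeomorph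
  surjective := Function.Surjective.comp Quotient.mk_surjective (Hyp.globalChart n).symm.surjective
  contDiff := by
    rintro _ ⟨w, -, rfl⟩
    exact P.contDiff_chartAction w
  map_eq := by
    rintro _ ⟨w, hw, rfl⟩ v
    refine (c.proj_eq_iff.2 ⟨w, hw, ?_⟩).symm
    exact ((Hyp.globalChart n).symm_apply_apply _).symm
  exists_eq v v' h := by
    obtain ⟨w, hw, h⟩ := c.proj_eq_iff.1 h
    exact ⟨_, ⟨w, hw, rfl⟩, by rw [RightAngledPolytope.chartAction, h, Homeomorph.apply_symm_apply]⟩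

theorem isOrientable_iff (hn : 2 ≤ n) :
    letI := (c.isDeckQuotient hn).chartedSpace
    IsOrientable n c.Cover ↔ ∀ w, c.hom w = 1 → P.sign w = 1 := by
  let := (c.isDeckQuotient hn).chartedSpace
  constructor
  · intro h w hw
    by_contra hs
    refine (c.isDeckQuotient hn).not_isOrientable ⟨w, hw, rfl⟩ (fun v => ?_) h
    have h1 := P.sign_mul_det_pos w v
    rw [(Int.units_eq_one_or _).resolve_left hs] at h1
    push_cast at h1
    linarith
  · intro h
    refine (c.isDeckQuotient hn).isOrientable ?_
    rintro _ ⟨w, hw, rfl⟩ v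
    have h1 := P.sign_mul_det_pos w v
    rw [h w hw] at h1
    simpa using h1

end Colouring

end

/-- For a colouring of a compact right-angled hyperbolic polytope, the quotient `M_λ` is a manifold,
with the (unique) smooth structure for which `ℍⁿ → M_λ` is a local diffeomorphism; if the colouring
spans `V`, then `M_λ` is orientable if and only if all colours have an odd number of ones under some
isomorphism `V ≅ 𝔽₂ˢ`; and `M_λ` is not orientable if three colours sum to zero. -/
theorem mainTheorem5 {n : ℕ} (hn : 2 ≤ n) {ι : Type*} (P : RightAngledPolytope n ι)
    {V : Type*} [AddCommGroup V] [Module (ZMod 2) V] [FiniteDimensional (ZMod 2) V]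
    (c : Colouring P V) :
    T2Space c.Cover ∧
    ∃ (_ : ChartedSpace (EuclideanSpace ℝ (Fin n)) c.Cover)
      (_ : IsManifold 𝓘(ℝ, EuclideanSpace ℝ (Fin n)) ∞ c.Cover),
      IsLocalDiffeomorph 𝓘(ℝ, EuclideanSpace ℝ (Fin n)) 𝓘(ℝ, EuclideanSpace ℝ (Fin n)) ∞ c.proj ∧
      (c.Spans →
        (IsOrientable n c.Cover ↔
          ∃ (s : ℕ) (e : V ≃ₗ[ZMod 2] (Fin s → ZMod 2)),
            ∀ F : ι, Odd (Finset.univ.filter (fun k : Fin s => e (c.colour F) k = 1)).card)) ∧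
      (∀ F F' F'' : ι, c.colour F + c.colour F' + c.colour F'' = 0 →
        ¬ IsOrientable n c.Cover) := by
  have h := c.isDeckQuotient hn
  refine ⟨c.t2Space_cover hn, h.chartedSpace, h.isManifold, ?_, fun hc => ?_, ?_⟩
  · have h1 := h.isLocalDiffeomorph (Hyp.globalChart n)
      (IsManifold.subset_maximalAtlas rfl)
    rwa [Function.comp_assoc, Homeomorph.symm_comp_self, Function.comp_id] at h1
  · exact (c.isOrientable_iff hn).trans (c.forall_sign_eq_one_iff_odd hc)
  · intro F F' F'' hF ho
    -- The product of the three reflections lies in the kernel and has sign `-1`; spanning plays no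
    -- role here.
    have h1 := (c.isOrientable_iff hn).1 ho (P.gen F * P.gen F' * P.gen F'') (by
      rw [map_mul, map_mul, c.hom_gen, c.hom_gen, c.hom_gen, ← ofAdd_add, ← ofAdd_add, hF,
        ofAdd_zero])
    rw [map_mul, map_mul, P.sign_gen, P.sign_gen, P.sign_gen] at h1
    exact absurd h1 (by decide)
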